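/- For $\lambda\in i\mathbb{R}$ let $\pi_\lambda$ be the even principal series representation of $PGL_2(\mathbb{R})$ on even homogeneous functions of degree $\lambda-1$ on $\mathbb{R}^2\setminus 0$, $\pi_\lambda(g)f(p)=|\det g|^{(\lambda-1)/2}f(g^{-1}p)$, realized on functions of $x\in\mathbb{R}$ by restriction to the line $\{(x,1)\}$, with the invariant Hermitian form $\langle v,u\rangle=\pi^{-1}\int_{\mathbb{R}}v(x)\overline{u(x)}\,dx$. For $n\in\mathbb{Z}$ put $e_n(x)=e^{in\arctan x}(1+x^2)^{(\lambda-1)/2}$. For $a\ge 1$ write $[a]=\mathrm{diag}(a^{-1},a)$; these elements form $A^-$, and integrals over $A^-$ are taken with respect to the measure $\rho(a)\,d[a]=\frac{a^2-a^{-2}}{2}\,\frac{da}{a}$, $a\ge 1$, coming from the Cartan decomposition. Let $\alpha_1:\mathbb{R}\to[0,1]$ be smooth, supported in $[0,1]$ and equal to $1$ on $[1/4,3/4]$, and put $\alpha_{\varepsilon,T}(a)=\alpha_1(\varepsilon^{-1}(T^{-1}a-1))$, a smoothed indicator of the shell $[T,T(1+\varepsilon)]$. Corollary. Let $\lambda\in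 i\mathbb{R}$ and $T_0>1$. There is $m_0$, depending only on $\lambda$ and $T_0$, such that for every $\alpha_1$ as above there is a constant $c>0$, depending only on $\lambda$, $T_0$ and $\alpha_1$, with the following property. Let $m\ge m_0$ and $n$ be positive integers, put $T=(n/m)^{1/2}$, suppose that $T\ge T_0$, and let $\varepsilon>0$ satisfy the Airy condition $$0\le\varepsilon\le (n/T^2)^{-2/3}\le \tfrac12 .$$ Then, with $\alpha=\alpha_{\varepsilon,T}$, $$\int_{A^-}|\langle\pi_\lambda([a])e_m,e_n\rangle|^2\,\alpha(a)\,\rho(a)\,da\;\ge\; c\,\varepsilon\, n^{-2/3}\,T^{4/3}.$$ -/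

import Mathlib

open scoped ContDiff

noncomputable section

/-- The function on the plane that is homogeneous of degree `lam - 1`
(`f (c p) = |c| ^ (lam - 1) f p`) and restricts to `v` on the line `{(x, 1)}`. -/
def homExt (lam : ℂ) (v : ℝ → ℂ) (p : Fin 2 → ℝ) : ℂ :=
  ((|p 1| : ℝ) : ℂ) ^ (lam - 1) * v (p 0 / p 1)

/-- The action of `GL₂(ℝ)` (through `PGL₂(ℝ)` on functions of homogeneous degree `lam - 1`):
`(π_lam(g) f)(p) = |det g| ^ ((lam - 1) / 2) f (g⁻¹ p)`. -/
def planeAction (lam : ℂ) (g : GL (Fin 2) ℝ) (f : (Fin 2 → ℝ) → ℂ) (p : Fin 2 → ℝ) : ℂ :=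
  ((|(g : Matrix (Fin 2) (Fin 2) ℝ).det| : ℝ) : ℂ) ^ ((lam - 1) / 2) *
    f (((g⁻¹ : GL (Fin 2) ℝ) : Matrix (Fin 2) (Fin 2) ℝ).mulVec p)

/-- The same representation in the line model: extend homogeneously, act, and restrict to the
line `{(x, 1)}`. -/
def lineAction (lam : ℂ) (g : GL (Fin 2) ℝ) (v : ℝ → ℂ) (x : ℝ) : ℂ :=
  planeAction lam g (homExt lam v) ![x, 1]

/-- The invariant Hermitian form in the line model, `⟨v, u⟩ = π⁻¹ ∫ v conj(u)`. -/
def lineInner (v u : ℝ → ℂ) : ℂ :=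
  ((Real.pi⁻¹ : ℝ) : ℂ) * ∫ t : ℝ, v t * (starRingEnd ℂ) (u t)

/-- The normalized vector of `K`-type `n` in the line model,
`e_n(x) = exp(i n arctan x) (1 + x²) ^ ((lam - 1) / 2)`. -/
def kType (lam : ℂ) (n : ℤ) (x : ℝ) : ℂ :=
  Complex.exp (Complex.I * n * (Real.arctan x : ℂ)) *
    ((1 + x ^ 2 : ℝ) : ℂ) ^ ((lam - 1) / 2)

/-- The element `[a] = diag(a⁻¹, a)`, for `a ≠ 0` (the value at `a = 0` is irrelevant).
For `a ≥ 1` these elements run through `A⁻`. -/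
def bracket (a : ℝ) : GL (Fin 2) ℝ :=
  if h : a ≠ 0 then
    Matrix.GeneralLinearGroup.mkOfDetNeZero !![a⁻¹, 0; 0, a] (by simp [Matrix.det_fin_two, h])
  else 1

/-- The matrix coefficient `⟨π_lam([a]) e_m, e_n⟩`. -/
def matrixCoeff (lam : ℂ) (m n : ℤ) (a : ℝ) : ℂ :=
  lineInner (lineAction lam (bracket a) (kType lam m)) (kType lam n)

/-- The density, with respect to Lebesgue measure in the coordinate `a ≥ 1` of `[a] ∈ A⁻`, of the
measure of the Cartan decomposition `K A⁻ K`: `ρ(a) d[a] = (a² - a⁻²) / 2 · da / a`. -/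
def cartanDensity (a : ℝ) : ℝ := (a ^ 2 - (a ^ 2)⁻¹) / 2 * a⁻¹

/-- A smooth cutoff profile: `0 ≤ α₁ ≤ 1`, supported in `[0, 1]`, and `α₁ = 1` on
`[1/4, 3/4]`. -/
structure IsCutoffProfile (α₁ : ℝ → ℝ) : Prop where
  smooth : ContDiff ℝ ∞ α₁
  nonneg : ∀ t, 0 ≤ α₁ t
  le_one : ∀ t, α₁ t ≤ 1
  support_subset : tsupport α₁ ⊆ Set.Icc 0 1
  eq_one : ∀ t ∈ Set.Icc (1 / 4 : ℝ) (3 / 4), α₁ t = 1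

/-- The smoothed indicator of the shell `[T, T (1 + ε)]`: `α_{ε,T}(a) = α₁(ε⁻¹ (T⁻¹ a - 1))`. -/
def shellCutoff (α₁ : ℝ → ℝ) (ε T a : ℝ) : ℝ := α₁ (ε⁻¹ * (T⁻¹ * a - 1))

/-- `∫_{A⁻} |⟨π_lam(a) e_m, e_n⟩|² α(a) ρ(a) da`, in the coordinate `a ≥ 1` of `[a] ∈ A⁻`. -/
def integratedCoeff (lam : ℂ) (m n : ℤ) (α : ℝ → ℝ) : ℝ :=
  ∫ a in Set.Ici (1 : ℝ), ‖matrixCoeff lam m n a‖ ^ 2 * α a * cartanDensity a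

/-- The Airy condition `0 ≤ ε ≤ (n / β²)^(-2/3) ≤ 1/2`. -/
def AiryCondition (n β ε : ℝ) : Prop :=
  0 ≤ ε ∧ ε ≤ (n / β ^ 2) ^ (-(2 / 3) : ℝ) ∧ (n / β ^ 2) ^ (-(2 / 3) : ℝ) ≤ 1 / 2

end

/-! Put `N = m^{1/3}` and substitute `x = u / (N a²)` in the matrix coefficient. Up to a factor of
modulus `π N a`, it becomes an oscillatory integral in `u` with parameters `κ = T²/a²` and `d =
a⁻²`. Since `arctan y = y - y³/3 + O(y⁵)`, for large `N` its phase approaches `σ u - (1 - d²) u³/3`,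
where `σ = N² (1 - κ)`, and its amplitude approaches `1`. For `a = T (1 + ε t)` one has `σ ≈ 2 t ε
N²`. As `n / T² = m`, the Airy condition says exactly `ε N² ≤ 1`, so `σ` stays bounded. The
assumption `T ≥ T₀ > 1` keeps `1 - d²` away from `0`, so the cubic does not degenerate.

The limit is an Airy integral, which extends to an entire function `G` of `σ` with `G 0 ≠ 0`
(`exists_entire_airy`). Convergence needs tails that are small uniformly in the parameters; this is
a first derivative test (`norm_integral_coeffIntegrand_le`).

`G` may have real zeros, so no pointwise lower bound is available, but its mean square over the
shell is positive: an entire function vanishing on a segment vanishes identically, and a segment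
shrunk to the origin is covered by `G 0 ≠ 0`. Compactness in `(ε N², T⁻²)` makes this uniform
(`exists_le_integral_norm_sq_coeffIntegral`). Undoing the scaling, with `ρ(a)` comparable to `a` and
a shell of width about `T ε`, gives the order `ε N⁻² = ε n^{-2/3} T^{4/3}`. -/

open MeasureTheory Filter Topology Set

/-! ### Airy integrals as entire functions -/

/-- Cubic decay beats any linear growth. -/
theorem exists_linear_sub_cubic_le (B : ℝ) {q : ℝ} (hq : 0 < q) :
    ∃ C : ℝ, ∀ r : ℝ, 0 ≤ r → B * r - q * r ^ 3 ≤ C - r := by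
  set a := Real.sqrt ((|B| + 1) / (3 * q)) with ha
  have ha0 : 0 ≤ a := Real.sqrt_nonneg _
  have ha2 : 3 * q * a ^ 2 = |B| + 1 := by
    rw [ha, Real.sq_sqrt (by positivity)]; field_simp
  -- `a` is the critical point of `(|B| + 1) r - q r³`, and `2 q a³` is the value there: `(r - a)²
  -- (r + 2a) = r³ - 3a² r + 2a³`.
  refine ⟨2 * q * a ^ 3, fun r hr => ?_⟩
  have h1 : 0 ≤ q * ((r - a) ^ 2 * (r + 2 * a)) := by positivity
  have h2 : B * r ≤ |B| * r := mul_le_mul_of_nonneg_right (le_abs_self B) hr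
  have h3 : 3 * q * a ^ 2 * r = (|B| + 1) * r := by rw [ha2]
  nlinarith

theorem integrableOn_exp_linear_sub_cubic (c : ℂ) {q : ℝ} (hq : 0 < q) :
    IntegrableOn (fun r : ℝ => Complex.exp (c * r - q * r ^ 3)) (Ioi 0) := by
  obtain ⟨C, hC⟩ := exists_linear_sub_cubic_le c.re hq
  refine Integrable.mono' (g := fun r => Real.exp C * Real.exp (-r))
    ((integrableOn_exp_neg_Ioi 0).const_mul _) (by fun_prop) ?_
  refine (ae_restrict_mem measurableSet_Ioi).mono fun r hr => ?_
  rw [Complex.norm_exp, ← Real.exp_add]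
  refine Real.exp_le_exp.2 ?_
  have := hC r (le_of_lt hr)
  have h2 : (c * (r : ℂ) - q * (r : ℂ) ^ 3).re = c.re * r - q * r ^ 3 := by
    have : (q * (r : ℂ) ^ 3) = ((q * r ^ 3 : ℝ) : ℂ) := by push_cast; ring
    rw [this, Complex.sub_re, Complex.ofReal_re, Complex.re_mul_ofReal]
  rw [h2]; linarith

/-- The Laplace transform of a cubic exponential is entire. -/
theorem differentiable_integral_exp_linear_sub_cubic (c : ℂ) {q : ℝ} (hq : 0 < q) :
    Differentiable ℂ (fun z : ℂ => ∫ r in Ioi (0 : ℝ), Complex.exp (c * z * r - q * r ^ 3)) := by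
  intro z₀
  set B := ‖c‖ * (‖z₀‖ + 1) with hB
  -- The extra `1` absorbs the factor `r ≤ exp r` produced by differentiating in `z`.
  obtain ⟨C, hC⟩ := exists_linear_sub_cubic_le (B + 1) hq
  refine (hasDerivAt_integral_of_dominated_loc_of_deriv_le (𝕜 := ℂ)
    (μ := volume.restrict (Ioi (0 : ℝ))) (Metric.ball_mem_nhds z₀ one_pos)
    (F := fun z r => Complex.exp (c * z * r - q * r ^ 3))
    (bound := fun r => ‖c‖ * (Real.exp C * Real.exp (-r)))
    (F' := fun z r => Complex.exp (c * z * r - q * r ^ 3) * (c * r))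
    (Eventually.of_forall fun z => by fun_prop) (integrableOn_exp_linear_sub_cubic _ hq)
    (by fun_prop) ?_ ?_ ?_).2.differentiableAt
  · refine (ae_restrict_mem measurableSet_Ioi).mono fun r hr z hz => ?_
    have hr0 : 0 ≤ r := le_of_lt hr
    rw [norm_mul, norm_mul, Complex.norm_exp, Complex.norm_real, Real.norm_of_nonneg hr0]
    have h2 : (c * z * (r : ℂ) - q * (r : ℂ) ^ 3).re = (c * z).re * r - q * r ^ 3 := by
      have : (q * (r : ℂ) ^ 3) = ((q * r ^ 3 : ℝ) : ℂ) := by push_cast; ring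
      rw [this, Complex.sub_re, Complex.ofReal_re, Complex.re_mul_ofReal]
    rw [h2]
    have h3 : (c * z).re ≤ B := by
      refine (Complex.re_le_norm _).trans ?_
      rw [norm_mul]
      have : ‖z‖ ≤ ‖z₀‖ + 1 := by
        have h := norm_le_norm_add_norm_sub' z z₀
        rw [Metric.mem_ball, dist_eq_norm] at hz
        linarith
      exact mul_le_mul_of_nonneg_left this (norm_nonneg _)
    have h4 : r ≤ Real.exp r := by linarith [Real.add_one_le_exp r]
    calc Real.exp ((c * z).re * r - q * r ^ 3) * (‖c‖ * r)
        ≤ Real.exp ((c * z).re * r - q * r ^ 3) * (‖c‖ * Real.exp r) := by gcongr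
      _ = ‖c‖ * Real.exp ((c * z).re * r - q * r ^ 3 + r) := by rw [Real.exp_add]; ring
      _ ≤ ‖c‖ * (Real.exp C * Real.exp (-r)) := by
        rw [← Real.exp_add]
        have := hC r hr0
        refine mul_le_mul_of_nonneg_left (Real.exp_le_exp.2 ?_) (norm_nonneg _)
        nlinarith [mul_le_mul_of_nonneg_right h3 hr0]
  · exact ((integrableOn_exp_neg_Ioi 0).const_mul _).const_mul _
  · refine Eventually.of_forall fun r z _ => ?_
    have h : HasDerivAt (fun z : ℂ => c * z * r - q * r ^ 3) (c * r) z := by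
      simpa using (((hasDerivAt_id z).const_mul c).mul_const (r : ℂ)).sub_const ((q : ℂ) * r ^ 3)
    exact h.cexp

/-- The Airy integral over a half line, by rotating the ray of integration. -/
theorem tendsto_integral_airy_half (σ : ℝ) {q s : ℝ} (hq : 0 < q) (hs : 0 < s)
    (hs2 : s ^ 2 = 1 / 3) :
    Tendsto (fun R : ℝ => ∫ u in (0 : ℝ)..R, Complex.exp (Complex.I * (σ * u - q * u ^ 3 / 3)))
      atTop (𝓝 ((1 - Complex.I * s) * ∫ r in Ioi (0 : ℝ),
        Complex.exp (Complex.I * (1 - Complex.I * s) * σ * r - (8 / 9 * q * s : ℝ) * r ^ 3))) := by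
  set w : ℂ := 1 - Complex.I * s with hw
  set f : ℂ → ℂ := fun z => Complex.exp (Complex.I * (σ * z - q * z ^ 3 / 3)) with hf
  have hfd : Differentiable ℂ f := by rw [hf]; fun_prop
  -- With a global primitive `F`, moving the contour amounts to comparing values of `F` at
  -- endpoints.
  obtain ⟨F, hF⟩ := hfd.isExactOn_univ
  replace hF : ∀ z, HasDerivAt F (f z) z := fun z => hF z (mem_univ z)
  have hs2' : (s : ℂ) ^ 2 = 1 / 3 := by rw [← Complex.ofReal_pow, hs2]; norm_num
  -- The ray through `w` has argument `-π/6`, so `w³` is a negative multiple of `i` and the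
  -- oscillating cubic becomes real decay.
  have hw3 : w ^ 3 = -(8 / 3 * s) * Complex.I := by
    have hI := Complex.I_sq
    have : w ^ 3 = 1 - 3 * Complex.I * s + 3 * Complex.I ^ 2 * s ^ 2
        - Complex.I ^ 2 * Complex.I * s ^ 2 * s := by rw [hw]; ring
    rw [this, hI, hs2']; ring
  have hseg : ∀ (p v : ℂ) (a b : ℝ),
      ∫ r in a..b, v * f (p + v * r) = F (p + v * b) - F (p + v * a) := by
    intro p v a b
    refine intervalIntegral.integral_eq_sub_of_hasDerivAt (f := fun r : ℝ => F (p + v * r))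
      (fun r _ => ?_) (Continuous.intervalIntegrable (by fun_prop) _ _)
    have h1 : HasDerivAt (fun r : ℝ => p + v * (r : ℂ)) v r := by
      simpa using ((Complex.ofRealCLM.hasDerivAt (x := r)).const_mul v).const_add p
    have h2 := (hF (p + v * r)).comp r h1
    rw [mul_comm]; exact h2
  have hray : ∀ r : ℝ, f (0 + w * r) =
      Complex.exp (Complex.I * w * σ * r - (8 / 9 * q * s : ℝ) * r ^ 3) := by
    intro r
    simp only [hf]
    congr 1
    have : Complex.I * (σ * (0 + w * r) - q * (0 + w * r) ^ 3 / 3)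
      = Complex.I * w * σ * r - Complex.I * q * w ^ 3 * r ^ 3 / 3 := by ring
    rw [this, hw3]
    have hI := Complex.I_mul_I
    push_cast
    linear_combination (-(8 / 9) * q * s * r ^ 3) * (-hI)
  have hlim : Tendsto (fun R : ℝ => ∫ r in (0 : ℝ)..R, w * f (0 + w * r)) atTop
      (𝓝 (w * ∫ r in Ioi (0 : ℝ),
        Complex.exp (Complex.I * w * σ * r - (8 / 9 * q * s : ℝ) * r ^ 3))) := by
    simp_rw [hray, intervalIntegral.integral_const_mul]
    exact (intervalIntegral_tendsto_integral_Ioi 0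
      (integrableOn_exp_linear_sub_cubic _ (by positivity)) tendsto_id).const_mul w
  have hdiff : ∀ R : ℝ, (∫ u in (0 : ℝ)..R, Complex.exp (Complex.I * (σ * u - q * u ^ 3 / 3)))
      = (∫ r in (0 : ℝ)..R, w * f (0 + w * r)) -
        ∫ t in (0 : ℝ)..(s * R), (-Complex.I) * f (R + (-Complex.I) * t) := by
    intro R
    have h1 := hseg 0 1 0 R
    have h2 := hseg 0 w 0 R
    have h3 := hseg R (-Complex.I) 0 (s * R)
    have e1 : (∫ u in (0 : ℝ)..R, Complex.exp (Complex.I * (σ * u - q * u ^ 3 / 3)))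
        = ∫ r in (0 : ℝ)..R, 1 * f (0 + 1 * r) := by simp [hf]
    rw [e1, h1, h2, h3]
    have e2 : (R : ℂ) + -Complex.I * ((s * R : ℝ) : ℂ) = 0 + w * R := by
      rw [hw]; push_cast; ring
    rw [e2]; simp
  have hzero : Tendsto (fun R : ℝ =>
      ∫ t in (0 : ℝ)..(s * R), (-Complex.I) * f (R + (-Complex.I) * t)) atTop (𝓝 0) := by
    have hk : Tendsto (fun R : ℝ => 8 / 9 * q * R ^ 2 - σ) atTop atTop :=
      tendsto_atTop_add_const_right _ _
        ((tendsto_pow_atTop two_ne_zero).const_mul_atTop (by positivity))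
    refine squeeze_zero_norm' (a := fun R : ℝ => (8 / 9 * q * R ^ 2 - σ)⁻¹) ?_
      (tendsto_inv_atTop_zero.comp hk)
    filter_upwards [hk.eventually_gt_atTop 0, eventually_gt_atTop 0] with R hk0 hR
    -- On the vertical leg from `R` to `w R` one has `t² ≤ R²/3`, so the exponent has real part `σ t
    -- - q (R² t - t³/3) ≤ -k t`.
    set k := 8 / 9 * q * R ^ 2 - σ with hkdef
    have hsR : 0 ≤ s * R := by positivity
    have hb : ∀ t ∈ Ioc 0 (s * R), ‖(-Complex.I) * f (R + (-Complex.I) * t)‖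
        ≤ Real.exp (-k * t) := by
      intro t ht
      simp only [hf]
      rw [norm_mul, norm_neg, Complex.norm_I, one_mul, Complex.norm_exp]
      refine Real.exp_le_exp.2 ?_
      have e : Complex.I * (σ * ((R : ℂ) + -Complex.I * t) - q * (R + -Complex.I * t) ^ 3 / 3)
          = ((σ * t - q * (R ^ 2 * t - t ^ 3 / 3) : ℝ) : ℂ) +
            ((σ * R - q * (R ^ 3 - 3 * R * t ^ 2) / 3 : ℝ) : ℂ) * Complex.I := by
        have hI2 := Complex.I_sq
        have hI4 : Complex.I ^ 4 = 1 := Complex.I_pow_four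
        have hI3 : Complex.I ^ 3 = -Complex.I := Complex.I_pow_three
        push_cast
        ring_nf
        simp only [hI2, hI3, hI4]
        ring
      rw [e]
      simp only [Complex.add_re, Complex.ofReal_re, Complex.re_ofReal_mul, Complex.I_re, mul_zero,
        add_zero]
      have h5 : t ^ 2 ≤ R ^ 2 / 3 := by
        have : t ^ 2 ≤ (s * R) ^ 2 := by
          have := ht.1; have := ht.2; gcongr
        rw [mul_pow, hs2] at this; linarith
      have h6 : q * t * t ^ 2 ≤ q * t * (R ^ 2 / 3) :=
        mul_le_mul_of_nonneg_left h5 (mul_nonneg hq.le ht.1.le)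
      rw [hkdef]; nlinarith
    calc _ ≤ ∫ t in (0 : ℝ)..(s * R), Real.exp (-k * t) :=
          intervalIntegral.norm_integral_le_of_norm_le hsR
            (Eventually.of_forall hb) (Continuous.intervalIntegrable (by fun_prop) _ _)
      _ ≤ k⁻¹ := by
        have : ∫ t in (0 : ℝ)..(s * R), Real.exp (-k * t)
            = (-k)⁻¹ • ∫ t in (-k * 0)..(-k * (s * R)), Real.exp t :=
          intervalIntegral.integral_comp_mul_left (f := Real.exp) (neg_ne_zero.2 hk0.ne')
        rw [this, integral_exp, smul_eq_mul, inv_neg, mul_zero, Real.exp_zero]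
        have h7 := Real.exp_pos (-k * (s * R))
        have h8 : 0 < k⁻¹ := inv_pos.2 hk0
        nlinarith
  have := hlim.sub hzero
  rw [sub_zero] at this
  exact this.congr fun R => (hdiff R).symm

/-- The symmetric Airy integrals converge to an entire function that does not vanish at `0`. -/
theorem exists_entire_airy {q : ℝ} (hq : 0 < q) :
    ∃ G : ℂ → ℂ, Differentiable ℂ G ∧ G 0 ≠ 0 ∧ ∀ σ : ℝ,
      Tendsto (fun R : ℝ => ∫ u in (-R)..R, Complex.exp (Complex.I * (σ * u - q * u ^ 3 / 3)))
        atTop (𝓝 (G σ)) := by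
  obtain ⟨s, hs, hs2⟩ : ∃ s : ℝ, 0 < s ∧ s ^ 2 = 1 / 3 :=
    ⟨Real.sqrt (1 / 3), by positivity, Real.sq_sqrt (by norm_num)⟩
  set w : ℂ := 1 - Complex.I * s with hw
  set q' : ℝ := 8 / 9 * q * s with hq'
  have hq'0 : 0 < q' := by positivity
  set L : ℂ → ℂ → ℂ := fun c z => ∫ r in Ioi (0 : ℝ), Complex.exp (c * z * r - q' * r ^ 3) with hL
  have hconj : (starRingEnd ℂ) w = 1 + Complex.I * s := by
    rw [hw]; simp
  have hLd : ∀ c, Differentiable ℂ (L c) := fun c =>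
    differentiable_integral_exp_linear_sub_cubic c hq'0
  -- The two half lines contribute complex conjugates for real `σ`. Conjugating only the constants,
  -- not `z`, keeps the second term holomorphic.
  refine ⟨fun z => w * L (Complex.I * w) z +
    (starRingEnd ℂ) w * L ((starRingEnd ℂ) (Complex.I * w)) z, ?_, ?_, ?_⟩
  · exact ((hLd _).const_mul _).add ((hLd _).const_mul _)
  · have hL0 : ∀ c, L c 0 = ((∫ r in Ioi (0 : ℝ), Real.exp (-q' * r ^ 3) : ℝ) : ℂ) := by
      intro c
      rw [hL, ← integral_complex_ofReal]
      refine integral_congr_ae (Eventually.of_forall fun r => ?_)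
      simp
    have hpos : 0 < ∫ r in Ioi (0 : ℝ), Real.exp (-q' * r ^ 3) := by
      rw [setIntegral_pos_iff_support_of_nonneg_ae]
      · have : Function.support (fun r : ℝ => Real.exp (-q' * r ^ 3)) = univ := by
          ext r; simp [(Real.exp_pos _).ne']
        rw [this]; simp
      · exact Eventually.of_forall fun r => (Real.exp_pos _).le
      · have h := (integrableOn_exp_linear_sub_cubic 0 hq'0).norm
        refine h.congr (Eventually.of_forall fun r => ?_)
        have : (0 * (r : ℂ) - q' * (r : ℂ) ^ 3) = ((-q' * r ^ 3 : ℝ) : ℂ) := by push_cast; ring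
        simp only [this, Complex.norm_exp, Complex.ofReal_re]
    simp only [hL0]
    rw [← add_mul, hconj, hw]
    have : (1 - Complex.I * s + (1 + Complex.I * s) : ℂ) = 2 := by ring
    rw [this]
    exact mul_ne_zero two_ne_zero (by exact_mod_cast hpos.ne')
  · intro σ
    have h1 := tendsto_integral_airy_half σ hq hs hs2
    have h2 := (Complex.continuous_conj.tendsto _).comp h1
    have hc : ∀ R : ℝ, (∫ u in (-R)..R, Complex.exp (Complex.I * (σ * u - q * u ^ 3 / 3)))
        = (∫ u in (0 : ℝ)..R, Complex.exp (Complex.I * (σ * u - q * u ^ 3 / 3))) +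
          (starRingEnd ℂ)
            (∫ u in (0 : ℝ)..R, Complex.exp (Complex.I * (σ * u - q * u ^ 3 / 3))) := by
      intro R
      have hcont : Continuous fun u : ℝ => Complex.exp (Complex.I * (σ * u - q * u ^ 3 / 3)) := by
        fun_prop
      rw [← intervalIntegral.integral_add_adjacent_intervals (b := 0)
        (hcont.intervalIntegrable _ _) (hcont.intervalIntegrable _ _), add_comm]
      congr 1
      rw [← intervalIntegral.intervalIntegral_conj]
      have := intervalIntegral.integral_comp_neg (a := 0) (b := R)
        (fun u : ℝ => Complex.exp (Complex.I * (σ * u - q * u ^ 3 / 3)))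
      rw [neg_zero] at this
      rw [← this]
      refine intervalIntegral.integral_congr fun u _ => ?_
      simp only [← Complex.exp_conj, map_mul, Complex.conj_I, map_sub, Complex.conj_ofReal, map_div₀,
        map_pow]
      congr 1
      push_cast
      simp only [map_ofNat]
      ring
    refine ((h1.add h2).congr fun R => (hc R).symm).trans_eq ?_
    congr 1
    rw [map_mul, ← integral_conj]
    congr 2
    refine integral_congr_ae (Eventually.of_forall fun r => ?_)
    simp only [← Complex.exp_conj, map_mul, map_sub, Complex.conj_ofReal, map_pow, hw, hq']

/-! ### The rescaled integral and uniform tail bounds -/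

/-- If `f` is close to `i` times the derivative of `W`, and `W` is dominated by a function `P` whose
decrease controls the discrepancy, then the integral of `f` is dominated by the initial value
of `P`. -/
theorem norm_integral_le_of_near_derivative {f W W' : ℝ → ℂ} {P P' : ℝ → ℝ} {B R S : ℝ}
    (hR : 0 < R) (hRS : R ≤ S) (hB : 0 ≤ B) (hf : Continuous f)
    (hW : ∀ u, R ≤ u → HasDerivAt W (W' u) u) (hP : ∀ u, R ≤ u → HasDerivAt P (P' u) u)
    (hWP : ∀ u, R ≤ u → ‖W u‖ ≤ P u)
    (hfW : ∀ u, R ≤ u → ‖f u - Complex.I * W' u‖ ≤ -P' u + B / u ^ 2) :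
    ‖∫ u in R..S, f u‖ ≤ 2 * P R + B / R := by
  -- The error `Z` vanishes at `R`, and its derivative is bounded by that of the explicit majorant
  -- `P R - P x + B (R⁻¹ - x⁻¹)`.
  set Z : ℝ → ℂ := fun x => (∫ u in R..x, f u) - Complex.I * (W x - W R) with hZ
  have hZd : ∀ x, R ≤ x → HasDerivAt Z (f x - Complex.I * W' x) x := fun x hx =>
    (intervalIntegral.integral_hasDerivAt_right (hf.intervalIntegrable _ _)
      (hf.stronglyMeasurableAtFilter _ _) hf.continuousAt).sub
      (((hW x hx).sub_const _).const_mul _)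
  have hEd : ∀ x, R ≤ x → HasDerivAt (fun x => P R - P x + B * (R⁻¹ - x⁻¹))
      (-P' x + B / x ^ 2) x := by
    intro x hx
    have hx0 : x ≠ 0 := (hR.trans_le hx).ne'
    have h := ((hP x hx).const_sub (P R)).add (((hasDerivAt_inv hx0).const_sub R⁻¹).const_mul B)
    refine h.congr_deriv ?_
    ring
  have hle := image_norm_le_of_norm_deriv_right_le_deriv_boundary' (a := R) (b := S)
    (f := Z) (f' := fun x => f x - Complex.I * W' x)
    (fun x hx => (hZd x hx.1).continuousAt.continuousWithinAt)
    (fun x hx => (hZd x hx.1).hasDerivWithinAt)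
    (B := fun x => P R - P x + B * (R⁻¹ - x⁻¹)) (B' := fun x => -P' x + B / x ^ 2)
    (by simp [hZ]) (fun x hx => (hEd x hx.1).continuousAt.continuousWithinAt)
    (fun x hx => (hEd x hx.1).hasDerivWithinAt) (fun x hx => hfW x hx.1) ⟨hRS, le_rfl⟩
  have h1 : (∫ u in R..S, f u) = Z S + Complex.I * (W S - W R) := by simp [hZ]
  have h2 : ‖Complex.I * (W S - W R)‖ ≤ P S + P R := by
    rw [norm_mul, Complex.norm_I, one_mul]
    exact (norm_sub_le _ _).trans (add_le_add (hWP S hRS) (hWP R le_rfl))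
  have h3 : 0 ≤ B * S⁻¹ := mul_nonneg hB (inv_nonneg.2 (hR.le.trans hRS))
  rw [h1, div_eq_mul_inv]
  refine (norm_add_le _ _).trans ?_
  linarith

/-- The phase of the rescaled matrix coefficient integral. -/
noncomputable def coeffPhase (μ N κ d u : ℝ) : ℝ :=
  N ^ 3 * (Real.arctan (u / N) - κ / d * Real.arctan (d * (u / N))) +
    μ / 2 * (Real.log (1 + (u / N) ^ 2) - Real.log (1 + (d * (u / N)) ^ 2))

/-- Half the logarithm of `(1 + (u / N)²) (1 + (d u / N)²)`. -/
noncomputable def coeffLogWeight (N d u : ℝ) : ℝ :=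
  (Real.log (1 + (u / N) ^ 2) + Real.log (1 + (d * (u / N)) ^ 2)) / 2

/-- The rescaled matrix coefficient integrand. -/
noncomputable def coeffIntegrand (μ N κ d u : ℝ) : ℂ :=
  Complex.exp ((-coeffLogWeight N d u : ℝ) + Complex.I * (coeffPhase μ N κ d u : ℝ))

theorem norm_coeffIntegrand (μ N κ d u : ℝ) :
    ‖coeffIntegrand μ N κ d u‖ = Real.exp (-coeffLogWeight N d u) := by
  rw [coeffIntegrand, Complex.norm_exp]; simp

theorem coeffLogWeight_nonneg (N d u : ℝ) : 0 ≤ coeffLogWeight N d u := by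
  have h1 : 0 ≤ Real.log (1 + (u / N) ^ 2) := Real.log_nonneg (by nlinarith [sq_nonneg (u / N)])
  have h2 : 0 ≤ Real.log (1 + (d * (u / N)) ^ 2) :=
    Real.log_nonneg (by nlinarith [sq_nonneg (d * (u / N))])
  unfold coeffLogWeight; linarith

theorem exp_coeffLogWeight_sq (N d u : ℝ) :
    Real.exp (coeffLogWeight N d u) ^ 2 = (1 + (u / N) ^ 2) * (1 + (d * (u / N)) ^ 2) := by
  rw [← Real.exp_nat_mul, coeffLogWeight]
  rw [show ((2 : ℕ) : ℝ) * ((Real.log (1 + (u / N) ^ 2) + Real.log (1 + (d * (u / N)) ^ 2)) / 2)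
    = Real.log (1 + (u / N) ^ 2) + Real.log (1 + (d * (u / N)) ^ 2) by push_cast; ring]
  rw [Real.exp_add, Real.exp_log (by positivity), Real.exp_log (by positivity)]

theorem norm_coeffIntegrand_le_one (μ N κ d u : ℝ) : ‖coeffIntegrand μ N κ d u‖ ≤ 1 := by
  rw [norm_coeffIntegrand, Real.exp_le_one_iff]
  linarith [coeffLogWeight_nonneg N d u]

theorem continuous_coeffIntegrand (μ N κ d : ℝ) : Continuous (coeffIntegrand μ N κ d) := by
  have h1 : ∀ u : ℝ, 1 + (u / N) ^ 2 ≠ 0 := fun u => by positivity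
  have h2 : ∀ u : ℝ, 1 + (d * (u / N)) ^ 2 ≠ 0 := fun u => by positivity
  unfold coeffIntegrand coeffPhase coeffLogWeight
  have := (Real.continuous_arctan)
  fun_prop (disch := assumption)

/-- For `d ≤ 1` the squared weight `(1 + y²)(1 + d² y²)`, `y = u / N`, is at least `(1 + d² y²)²`,
so the modulus is at most a Cauchy density up to scaling. -/
theorem integrable_coeffIntegrand (μ κ : ℝ) {N d : ℝ} (hN : 0 < N) (hd : 0 < d) (hd1 : d ≤ 1) :
    Integrable (coeffIntegrand μ N κ d) := by
  have h1 : Integrable fun u : ℝ => (1 + (d / N * u) ^ 2)⁻¹ :=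
    integrable_inv_one_add_sq.comp_mul_left' (by positivity)
  refine h1.mono' (continuous_coeffIntegrand μ N κ d).aestronglyMeasurable
    (Eventually.of_forall fun u => ?_)
  have hsq := exp_coeffLogWeight_sq N d u
  have hpos := Real.exp_pos (coeffLogWeight N d u)
  rw [norm_coeffIntegrand, Real.exp_neg]
  refine inv_anti₀ (by positivity) ?_
  have h3 : (d * (u / N)) ^ 2 ≤ (u / N) ^ 2 := by
    rw [mul_pow]; exact mul_le_of_le_one_left (sq_nonneg _) (pow_le_one₀ hd.le hd1)
  have h4 : d / N * u = d * (u / N) := by ring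
  rw [h4]
  refine abs_le_of_sq_le_sq' ?_ hpos.le |>.2
  rw [hsq, sq]
  gcongr

/-- The arctangent part of the phase is odd and the logarithmic part even. This reduces the left
tail to the right tail for `-μ`. -/
theorem coeffIntegrand_neg (μ N κ d u : ℝ) :
    coeffIntegrand μ N κ d (-u) = (starRingEnd ℂ) (coeffIntegrand (-μ) N κ d u) := by
  have h1 : coeffLogWeight N d (-u) = coeffLogWeight N d u := by
    simp [coeffLogWeight, neg_div]
  have h2 : coeffPhase μ N κ d (-u) = -coeffPhase (-μ) N κ d u := by
    simp only [coeffPhase, neg_div, mul_neg, Real.arctan_neg, neg_sq]; ring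
  rw [coeffIntegrand, coeffIntegrand, ← Complex.exp_conj, h1, h2]
  simp

theorem hasDerivAt_log_one_add_sq (c u : ℝ) :
    HasDerivAt (fun u : ℝ => Real.log (1 + (c * u) ^ 2)) (2 * c ^ 2 * u / (1 + (c * u) ^ 2)) u := by
  have h : HasDerivAt (fun u : ℝ => 1 + (c * u) ^ 2) (2 * c ^ 2 * u) u := by
    have := (((hasDerivAt_id' u).const_mul c).pow 2).const_add 1
    refine this.congr_deriv ?_
    push_cast; ring
  exact h.log (by positivity)

theorem hasDerivAt_arctan_mul (c u : ℝ) :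
    HasDerivAt (fun u : ℝ => Real.arctan (c * u)) (c / (1 + (c * u) ^ 2)) u := by
  have := (((hasDerivAt_id' u).const_mul c)).arctan
  refine this.congr_deriv ?_
  ring

theorem hasDerivAt_coeffLogWeight (N d u : ℝ) :
    HasDerivAt (coeffLogWeight N d) ((2 * N⁻¹ ^ 2 * u / (1 + (N⁻¹ * u) ^ 2) +
      2 * (d * N⁻¹) ^ 2 * u / (1 + (d * N⁻¹ * u) ^ 2)) / 2) u := by
  have h := ((hasDerivAt_log_one_add_sq N⁻¹ u).add
    (hasDerivAt_log_one_add_sq (d * N⁻¹) u)).div_const 2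
  refine h.congr_of_eventuallyEq (Eventually.of_forall fun v => ?_)
  simp only [coeffLogWeight, Pi.add_apply]
  rw [show v / N = N⁻¹ * v by ring, show d * (N⁻¹ * v) = d * N⁻¹ * v by ring]

theorem hasDerivAt_coeffPhase (μ N κ d u : ℝ) :
    HasDerivAt (coeffPhase μ N κ d)
      (N ^ 3 * (N⁻¹ / (1 + (N⁻¹ * u) ^ 2) - κ / d * (d * N⁻¹ / (1 + (d * N⁻¹ * u) ^ 2))) +
      μ / 2 * (2 * N⁻¹ ^ 2 * u / (1 + (N⁻¹ * u) ^ 2) -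
      2 * (d * N⁻¹) ^ 2 * u / (1 + (d * N⁻¹ * u) ^ 2))) u := by
  have h := (((hasDerivAt_arctan_mul N⁻¹ u).sub
    ((hasDerivAt_arctan_mul (d * N⁻¹) u).const_mul (κ / d))).const_mul (N ^ 3)).add
    (((hasDerivAt_log_one_add_sq N⁻¹ u).sub
    (hasDerivAt_log_one_add_sq (d * N⁻¹) u)).const_mul (μ / 2))
  refine h.congr_of_eventuallyEq (Eventually.of_forall fun v => ?_)
  simp only [coeffPhase, Pi.add_apply, Pi.sub_apply]
  rw [show v / N = N⁻¹ * v by ring, show d * (N⁻¹ * v) = d * N⁻¹ * v by ring]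

/-- First derivative test for the rescaled matrix coefficient integral, away from the Airy
region. -/
theorem norm_integral_coeffIntegrand_le (μ : ℝ) {N κ d R S : ℝ} (hd : 0 < d) (hd1 : d ≤ 1)
    (hκ : κ ≤ 1) (hA : 0 < κ - d ^ 2) (hR : 0 < R) (hRN : R ≤ N)
    (hs : 2 * (N ^ 2 * (1 - κ)) ≤ (κ - d ^ 2) * R ^ 2) (hRS : R ≤ S) :
    ‖∫ u in R..S, coeffIntegrand μ N κ d u‖ ≤ (8 + 2 * |μ|) / ((κ - d ^ 2) * R ^ 2) := by
  have hN : 0 < N := hR.trans_le hRN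
  set A := κ - d ^ 2 with hAdef
  set s := N ^ 2 * (1 - κ) with hsdef
  have hs0 : 0 ≤ s := mul_nonneg (sq_nonneg _) (by linarith)
  have hV : ∀ u, R ≤ u → A * u ^ 2 / 2 ≤ A * u ^ 2 - s := by
    intro u hu
    have : A * R ^ 2 ≤ A * u ^ 2 := by gcongr
    linarith
  have hV0 : ∀ u, R ≤ u → 0 < A * u ^ 2 - s := by
    intro u hu
    have hu0 : 0 < u := hR.trans_le hu
    exact lt_of_lt_of_le (by positivity) (hV u hu)
  -- The arctangent part of the phase has derivative `-(A u² - s) / (D1 D2)`, and the amplitude is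
  -- `(D1 D2)^{-1/2}`. Thus `exp p` is amplitude divided by phase derivative in absolute value, the
  -- boundary term of an integration by parts.
  set p : ℝ → ℝ := fun u => coeffLogWeight N d u - Real.log (A * u ^ 2 - s) with hp
  have hexp : ∀ u, R ≤ u → Real.exp (p u) =
      Real.exp (coeffLogWeight N d u) / (A * u ^ 2 - s) := by
    intro u hu
    rw [hp, Real.exp_sub, Real.exp_log (hV0 u hu)]
  set ψ := coeffPhase μ N κ d with hψ
  set D1 : ℝ → ℝ := fun u => 1 + (N⁻¹ * u) ^ 2 with hD1
  set D2 : ℝ → ℝ := fun u => 1 + (d * N⁻¹ * u) ^ 2 with hD2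
  have hD1p : ∀ u, 0 < D1 u := fun u => by simp only [hD1]; positivity
  have hD2p : ∀ u, 0 < D2 u := fun u => by simp only [hD2]; positivity
  have hE2 : ∀ u, Real.exp (coeffLogWeight N d u) ^ 2 = D1 u * D2 u := by
    intro u
    rw [exp_coeffLogWeight_sq, hD1, hD2]
    simp only
    rw [show u / N = N⁻¹ * u by ring, show d * (N⁻¹ * u) = d * N⁻¹ * u by ring]
  set p' : ℝ → ℝ := fun u => (2 * N⁻¹ ^ 2 * u / D1 u + 2 * (d * N⁻¹) ^ 2 * u / D2 u) / 2
    - 2 * A * u / (A * u ^ 2 - s) with hp'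
  set χ' : ℝ → ℝ := fun u => μ / 2 * (2 * N⁻¹ ^ 2 * u / D1 u - 2 * (d * N⁻¹) ^ 2 * u / D2 u)
    with hχ'
  set ψ' : ℝ → ℝ := fun u => -(A * u ^ 2 - s) / (D1 u * D2 u) + χ' u with hψ'
  have hpd : ∀ u, R ≤ u → HasDerivAt p (p' u) u := by
    intro u hu
    have h1 : HasDerivAt (fun u : ℝ => A * u ^ 2 - s) (2 * A * u) u := by
      refine (((hasDerivAt_pow 2 u).const_mul A).sub_const s).congr_deriv ?_
      simp; ring
    exact (hasDerivAt_coeffLogWeight N d u).sub (h1.log (hV0 u hu).ne')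
  have hψd : ∀ u, HasDerivAt ψ (ψ' u) u := by
    intro u
    refine (hasDerivAt_coeffPhase μ N κ d u).congr_deriv ?_
    simp only [hψ', hχ']
    congr 1
    have h1 := (hD1p u).ne'
    have h2 := (hD2p u).ne'
    change N ^ 3 * (N⁻¹ / D1 u - κ / d * (d * N⁻¹ / D2 u)) = _
    have h3 : N ^ 3 * (N⁻¹ / D1 u - κ / d * (d * N⁻¹ / D2 u))
        = N ^ 2 * (D2 u - κ * D1 u) / (D1 u * D2 u) := by
      field_simp
    rw [h3]
    congr 1
    simp only [hD1, hD2, hAdef, hsdef]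
    field_simp
    ring
  -- The weight grows with logarithmic derivative at most `2/u`, while `A u² - s` has logarithmic
  -- derivative at least `2/u`, as `s ≥ 0`.
  have hp'0 : ∀ u, R ≤ u → p' u ≤ 0 := by
    intro u hu
    have hu0 : 0 < u := hR.trans_le hu
    have h1 : 2 * N⁻¹ ^ 2 * u / D1 u ≤ 2 / u := by
      rw [div_le_div_iff₀ (hD1p u) hu0]
      simp only [hD1]; nlinarith
    have h2 : 2 * (d * N⁻¹) ^ 2 * u / D2 u ≤ 2 / u := by
      rw [div_le_div_iff₀ (hD2p u) hu0]
      simp only [hD2]; nlinarith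
    have h3 : 2 / u ≤ 2 * A * u / (A * u ^ 2 - s) := by
      rw [div_le_div_iff₀ hu0 (hV0 u hu)]
      nlinarith
    simp only [hp']; linarith
  -- The logarithmic part of the phase is treated as an error. Its contribution is integrable
  -- because the weight is at least `u / N`.
  have hχb : ∀ u, R ≤ u → Real.exp (p u) * |χ' u| ≤ 2 * |μ| / (A * N) / u ^ 2 := by
    intro u hu
    have hu0 : 0 < u := hR.trans_le hu
    set E := Real.exp (coeffLogWeight N d u) with hE
    have hE0 : 0 < E := Real.exp_pos _
    have hEy : u / N ≤ E := by
      refine abs_le_of_sq_le_sq' ?_ hE0.le |>.2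
      rw [hE2]
      have : 1 ≤ D2 u := by simp only [hD2]; nlinarith [sq_nonneg (d * N⁻¹ * u)]
      have h4 : (u / N) ^ 2 ≤ D1 u := by
        simp only [hD1]; rw [show u / N = N⁻¹ * u by ring]; linarith
      calc (u / N) ^ 2 ≤ D1 u := h4
        _ ≤ D1 u * D2 u := le_mul_of_one_le_right (hD1p u).le this
    have hchi : χ' u = μ * (u / N ^ 2) * (1 - d ^ 2) / E ^ 2 := by
      rw [hE2]
      have h1 := (hD1p u).ne'
      have h2 := (hD2p u).ne'
      simp only [hχ']
      rw [eq_div_iff (mul_ne_zero h1 h2)]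
      have : μ / 2 * (2 * N⁻¹ ^ 2 * u / D1 u - 2 * (d * N⁻¹) ^ 2 * u / D2 u) * (D1 u * D2 u)
          = μ * N⁻¹ ^ 2 * u * (D2 u - d ^ 2 * D1 u) := by
        field_simp
      rw [this]
      simp only [hD1, hD2]
      field_simp
      ring
    have hdd : |1 - d ^ 2| ≤ 1 := by
      rw [abs_le]; constructor <;> nlinarith
    rw [hexp u hu, hchi, abs_div, abs_mul, abs_mul, abs_of_pos (show 0 < u / N ^ 2 by positivity),
      abs_of_pos (show 0 < E ^ 2 by positivity)]
    calc E / (A * u ^ 2 - s) * (|μ| * (u / N ^ 2) * |1 - d ^ 2| / E ^ 2)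
        ≤ E / (A * u ^ 2 / 2) * (|μ| * (u / N ^ 2) * 1 / E ^ 2) := by
          have := hV u hu
          gcongr
      _ = 2 * |μ| / (A * N) / u ^ 2 * ((u / N) / E) := by field_simp
      _ ≤ 2 * |μ| / (A * N) / u ^ 2 * 1 := by
          gcongr
          rw [div_le_one hE0]; exact hEy
      _ = _ := mul_one _
  set W : ℝ → ℂ := fun u => Complex.exp ((p u : ℝ) + Complex.I * (ψ u : ℝ)) with hW
  have hWn : ∀ u, ‖W u‖ = Real.exp (p u) := fun u => by
    simp only [hW]
    rw [Complex.norm_exp]; simp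
  have hmain := norm_integral_le_of_near_derivative (f := coeffIntegrand μ N κ d) (W := W)
    (W' := fun u => W u * ((p' u : ℝ) + Complex.I * (ψ' u : ℝ)))
    (P := fun u => Real.exp (p u)) (P' := fun u => Real.exp (p u) * p' u)
    (B := 2 * |μ| / (A * N)) hR hRS (by positivity) (continuous_coeffIntegrand μ N κ d)
    (fun u hu => ((hpd u hu).ofReal_comp.add ((hψd u).ofReal_comp.const_mul Complex.I)).cexp)
    (fun u hu => (hpd u hu).exp) (fun u _ => (hWn u).le)
    (fun u hu => by
      have hf : coeffIntegrand μ N κ d u = W u * ((A * u ^ 2 - s) / (D1 u * D2 u) : ℝ) := by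
        have h1 : ((A * u ^ 2 - s) / (D1 u * D2 u) : ℝ) =
            Real.exp (Real.log (A * u ^ 2 - s) - 2 * coeffLogWeight N d u) := by
          rw [Real.exp_sub, Real.exp_log (hV0 u hu), ← hE2]
          congr 1
          rw [← Real.exp_nat_mul]; norm_num
        rw [h1, coeffIntegrand, hW]
        simp only
        rw [Complex.ofReal_exp, ← Complex.exp_add]
        congr 1
        simp only [hp]
        push_cast; ring
      have hdiff : coeffIntegrand μ N κ d u - Complex.I * (W u * ((p' u : ℝ) +
          Complex.I * (ψ' u : ℝ))) = W u * ((χ' u : ℝ) - Complex.I * (p' u : ℝ)) := by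
        rw [hf]
        simp only [hψ']
        have hI := Complex.I_mul_I
        push_cast
        linear_combination (-W u * (-(A * u ^ 2 - s) / (D1 u * D2 u) + χ' u)) * hI
      rw [hdiff, norm_mul, hWn]
      have hn : ‖((χ' u : ℝ) : ℂ) - Complex.I * (p' u : ℝ)‖ ≤ |χ' u| + -p' u := by
        refine (norm_sub_le _ _).trans ?_
        rw [norm_mul, Complex.norm_I, one_mul, Complex.norm_real, Complex.norm_real,
          Real.norm_eq_abs, Real.norm_eq_abs, abs_of_nonpos (hp'0 u hu)]
      calc Real.exp (p u) * _ ≤ Real.exp (p u) * (|χ' u| + -p' u) := by gcongr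
        _ ≤ _ := by have := hχb u hu; linarith)
  refine hmain.trans ?_
  have hPR : Real.exp (p R) ≤ 4 / (A * R ^ 2) := by
    rw [hexp R le_rfl]
    have hE : Real.exp (coeffLogWeight N d R) ≤ 2 := by
      refine abs_le_of_sq_le_sq' ?_ (by norm_num) |>.2
      rw [hE2]
      have hRN' : N⁻¹ * R ≤ 1 := by rw [inv_mul_le_iff₀ hN]; linarith
      have hRN0 : 0 ≤ N⁻¹ * R := by positivity
      have h1 : D1 R ≤ 2 := by simp only [hD1]; nlinarith
      have h2 : D2 R ≤ 2 := by
        have : d * N⁻¹ * R ≤ 1 := by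
          rw [mul_assoc]; exact mul_le_one₀ hd1 hRN0 hRN'
        have h0 : 0 ≤ d * N⁻¹ * R := by positivity
        simp only [hD2]; nlinarith
      calc D1 R * D2 R ≤ 2 * 2 := by have := hD2p R; gcongr
        _ = 2 ^ 2 := by norm_num
    calc _ ≤ 2 / (A * R ^ 2 / 2) := by have := hV R le_rfl; gcongr
      _ = _ := by field_simp; norm_num
  have h5 : 2 * |μ| / (A * N) / R ≤ 2 * |μ| / (A * R ^ 2) := by
    rw [div_div]
    refine div_le_div_of_nonneg_left (by positivity) (by positivity) ?_
    rw [mul_assoc, sq]; gcongr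
  calc _ ≤ 2 * (4 / (A * R ^ 2)) + 2 * |μ| / (A * R ^ 2) := by gcongr
    _ = _ := by ring

theorem norm_integral_sub_integral_coeffIntegrand_le (μ : ℝ) {N κ d R : ℝ} (hd : 0 < d)
    (hd1 : d ≤ 1) (hκ : κ ≤ 1) (hA : 0 < κ - d ^ 2) (hR : 0 < R) (hRN : R ≤ N)
    (hs : 2 * (N ^ 2 * (1 - κ)) ≤ (κ - d ^ 2) * R ^ 2) :
    ‖(∫ u, coeffIntegrand μ N κ d u) - ∫ u in (-R)..R, coeffIntegrand μ N κ d u‖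
      ≤ 2 * ((8 + 2 * |μ|) / ((κ - d ^ 2) * R ^ 2)) := by
  have hN : 0 < N := hR.trans_le hRN
  have hint := integrable_coeffIntegrand μ κ hN hd hd1
  have hlim := (intervalIntegral_tendsto_integral hint tendsto_neg_atTop_atBot tendsto_id).sub_const
    (∫ u in (-R)..R, coeffIntegrand μ N κ d u)
  refine le_of_tendsto hlim.norm ?_
  filter_upwards [eventually_ge_atTop R] with S hS
  have hii : ∀ a b, IntervalIntegrable (coeffIntegrand μ N κ d) volume a b := fun a b =>
    (continuous_coeffIntegrand μ N κ d).intervalIntegrable a b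
  have hsplit : (∫ u in (-S)..(id S), coeffIntegrand μ N κ d u) -
      (∫ u in (-R)..R, coeffIntegrand μ N κ d u) =
      (∫ u in (-S)..(-R), coeffIntegrand μ N κ d u) + ∫ u in R..S, coeffIntegrand μ N κ d u := by
    have h1 := intervalIntegral.integral_add_adjacent_intervals (hii (-S) (-R)) (hii (-R) R)
    have h2 := intervalIntegral.integral_add_adjacent_intervals (hii (-S) R) (hii R S)
    simp only [id]
    rw [← h2, ← h1]; ring
  have hneg : ‖∫ u in (-S)..(-R), coeffIntegrand μ N κ d u‖ ≤
      (8 + 2 * |μ|) / ((κ - d ^ 2) * R ^ 2) := by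
    rw [← intervalIntegral.integral_comp_neg]
    simp_rw [coeffIntegrand_neg]
    rw [intervalIntegral.intervalIntegral_conj, RCLike.norm_conj]
    simpa using norm_integral_coeffIntegrand_le (-μ) hd hd1 hκ hA hR hRN hs hS
  have hpos := norm_integral_coeffIntegrand_le μ hd hd1 hκ hA hR hRN hs hS
  rw [hsplit]
  refine (norm_add_le _ _).trans ?_
  linarith

/-- The integrand has modulus at most `1` on `[-R, R]`, whence the `2 R`. With `R` fixed this
supplies the dominating constant for the later limit over the shell. -/
theorem norm_integral_coeffIntegrand_le_of_le (μ : ℝ) {N κ d R : ℝ} (hd : 0 < d)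
    (hd1 : d ≤ 1) (hκ : κ ≤ 1) (hA : 0 < κ - d ^ 2) (hR : 0 < R) (hRN : R ≤ N)
    (hs : 2 * (N ^ 2 * (1 - κ)) ≤ (κ - d ^ 2) * R ^ 2) :
    ‖∫ u, coeffIntegrand μ N κ d u‖ ≤ 2 * ((8 + 2 * |μ|) / ((κ - d ^ 2) * R ^ 2)) + 2 * R := by
  have h1 := norm_integral_sub_integral_coeffIntegrand_le μ hd hd1 hκ hA hR hRN hs
  have h2 : ‖∫ u in (-R)..R, coeffIntegrand μ N κ d u‖ ≤ 1 * |R - -R| :=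
    intervalIntegral.norm_integral_le_of_norm_le_const fun u _ =>
      norm_coeffIntegrand_le_one μ N κ d u
  rw [abs_of_pos (by linarith)] at h2
  have h3 := norm_add_le ((∫ u, coeffIntegrand μ N κ d u) -
    ∫ u in (-R)..R, coeffIntegrand μ N κ d u) (∫ u in (-R)..R, coeffIntegrand μ N κ d u)
  rw [sub_add_cancel] at h3
  linarith

/-! ### Convergence to the Airy integral -/

/-- The difference has derivative `y⁴ / (1 + y²)`. At `x = u / N` the fifth power beats the factor
`N³` in the phase. -/
theorem abs_arctan_sub_cubic_le (x : ℝ) : |Real.arctan x - (x - x ^ 3 / 3)| ≤ |x| ^ 5 := by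
  have hd : ∀ y : ℝ, HasDerivAt (fun y => Real.arctan y - (y - y ^ 3 / 3))
      (y ^ 4 / (1 + y ^ 2)) y := by
    intro y
    have h := (Real.hasDerivAt_arctan y).sub
      ((hasDerivAt_id' y).sub ((hasDerivAt_pow 3 y).div_const 3))
    refine h.congr_deriv ?_
    have : 1 + y ^ 2 ≠ 0 := by positivity
    field_simp
    push_cast
    ring
  have h := (convex_Icc (-|x|) |x|).norm_image_sub_le_of_norm_hasDerivWithin_le
    (f := fun y => Real.arctan y - (y - y ^ 3 / 3)) (C := |x| ^ 4)
    (fun y _ => (hd y).hasDerivWithinAt) (fun y hy => by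
      have h1 : |y| ≤ |x| := abs_le.2 hy
      have h2 : y ^ 4 ≤ |x| ^ 4 := by
        rw [← Even.pow_abs (by decide : Even 4) y]; gcongr
      rw [Real.norm_of_nonneg (by positivity), div_le_iff₀ (by positivity)]
      nlinarith [sq_nonneg y, pow_nonneg (abs_nonneg x) 4])
    (x := 0) (y := x) ⟨by simp, by simp⟩ ⟨neg_abs_le x, le_abs_self x⟩
  simp only [Real.norm_eq_abs] at h
  calc _ = |Real.arctan x - (x - x ^ 3 / 3) - (Real.arctan 0 - (0 - 0 ^ 3 / 3))| := by simp
    _ ≤ |x| ^ 4 * |x - 0| := h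
    _ = |x| ^ 5 := by rw [sub_zero]; ring

theorem tendsto_coeffLogWeight {N d : ℕ → ℝ} {δ : ℝ} (hN : Tendsto N atTop atTop)
    (hd : Tendsto d atTop (𝓝 δ)) (u : ℝ) :
    Tendsto (fun k => Real.log (1 + (u / N k) ^ 2)) atTop (𝓝 0) ∧
      Tendsto (fun k => Real.log (1 + (d k * (u / N k)) ^ 2)) atTop (𝓝 0) := by
  have h0 : Tendsto (fun k => u / N k) atTop (𝓝 0) := tendsto_const_nhds.div_atTop hN
  have hl : Tendsto Real.log (𝓝 1) (𝓝 0) := by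
    simpa using (Real.continuousAt_log one_ne_zero).tendsto
  constructor
  · refine hl.comp ?_
    simpa using (h0.pow 2).const_add 1
  · refine hl.comp ?_
    simpa using ((hd.mul h0).pow 2).const_add 1

theorem tendsto_coeffPhase (μ : ℝ) {N κ d : ℕ → ℝ} {σ δ : ℝ} (hN : Tendsto N atTop atTop)
    (hd0 : ∀ k, 0 < d k) (hd : Tendsto d atTop (𝓝 δ)) (hκ : Tendsto κ atTop (𝓝 1))
    (hσ : Tendsto (fun k => N k ^ 2 * (1 - κ k)) atTop (𝓝 σ)) (u : ℝ) :
    Tendsto (fun k => coeffPhase μ (N k) (κ k) (d k) u) atTop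
      (𝓝 (σ * u - (1 - δ ^ 2) * u ^ 3 / 3)) := by
  obtain ⟨hl1, hl2⟩ := tendsto_coeffLogWeight hN hd u
  have hN2 : Tendsto (fun k => (N k ^ 2)⁻¹) atTop (𝓝 0) :=
    tendsto_inv_atTop_zero.comp ((tendsto_pow_atTop two_ne_zero).comp hN)
  have hmain : Tendsto (fun k => N k ^ 2 * (1 - κ k) * u - (1 - κ k * d k ^ 2) * u ^ 3 / 3) atTop
      (𝓝 (σ * u - (1 - 1 * δ ^ 2) * u ^ 3 / 3)) :=
    (hσ.mul_const u).sub ((((hκ.mul (hd.pow 2)).const_sub 1).mul_const (u ^ 3)).div_const 3)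
  have herr : Tendsto (fun k => N k ^ 3 * (Real.arctan (u / N k) -
      κ k / d k * Real.arctan (d k * (u / N k))) -
      (N k ^ 2 * (1 - κ k) * u - (1 - κ k * d k ^ 2) * u ^ 3 / 3)) atTop (𝓝 0) := by
    have hb : Tendsto (fun k => |u| ^ 5 * (N k ^ 2)⁻¹ * (1 + |κ k| * d k ^ 4)) atTop (𝓝 0) := by
      have := (hN2.const_mul (|u| ^ 5)).mul ((hκ.abs.mul (hd.pow 4)).const_add 1)
      simpa using this
    refine squeeze_zero_norm' ?_ hb
    filter_upwards [hN.eventually_gt_atTop 0] with k hNk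
    have hdk := hd0 k
    set y := u / N k with hy
    have h1 := abs_arctan_sub_cubic_le y
    have h2 := abs_arctan_sub_cubic_le (d k * y)
    have hu : u = N k * y := by rw [hy]; field_simp
    have hid : N k ^ 3 * (Real.arctan y - κ k / d k * Real.arctan (d k * y)) -
        (N k ^ 2 * (1 - κ k) * u - (1 - κ k * d k ^ 2) * u ^ 3 / 3) =
        N k ^ 3 * ((Real.arctan y - (y - y ^ 3 / 3)) -
          κ k / d k * (Real.arctan (d k * y) - (d k * y - (d k * y) ^ 3 / 3))) := by
      rw [hu]; field_simp; ring
    rw [hid, norm_mul, Real.norm_of_nonneg (by positivity), Real.norm_eq_abs]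
    have h3 : |(Real.arctan y - (y - y ^ 3 / 3)) -
        κ k / d k * (Real.arctan (d k * y) - (d k * y - (d k * y) ^ 3 / 3))| ≤
        |y| ^ 5 + |κ k| / d k * |d k * y| ^ 5 := by
      refine (abs_sub _ _).trans ?_
      rw [abs_mul, abs_div, abs_of_pos hdk]
      gcongr
    calc _ ≤ N k ^ 3 * (|y| ^ 5 + |κ k| / d k * |d k * y| ^ 5) := by gcongr
      _ = _ := by
        rw [hu, abs_mul, abs_mul, abs_of_pos hdk, abs_of_pos hNk]
        field_simp
  have hχ := (hl1.sub hl2).const_mul (μ / 2)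
  have := (hmain.add herr).add hχ
  simp only [sub_zero, mul_zero, add_zero, one_mul] at this
  refine this.congr fun k => ?_
  simp only [coeffPhase]; ring

theorem tendsto_coeffIntegrand (μ : ℝ) {N κ d : ℕ → ℝ} {σ δ : ℝ} (hN : Tendsto N atTop atTop)
    (hd0 : ∀ k, 0 < d k) (hd : Tendsto d atTop (𝓝 δ)) (hκ : Tendsto κ atTop (𝓝 1))
    (hσ : Tendsto (fun k => N k ^ 2 * (1 - κ k)) atTop (𝓝 σ)) (u : ℝ) :
    Tendsto (fun k => coeffIntegrand μ (N k) (κ k) (d k) u) atTop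
      (𝓝 (Complex.exp (Complex.I * (σ * u - (1 - δ ^ 2 : ℝ) * u ^ 3 / 3)))) := by
  obtain ⟨hl1, hl2⟩ := tendsto_coeffLogWeight hN hd u
  have h1 : Tendsto (fun k => -coeffLogWeight (N k) (d k) u) atTop (𝓝 0) := by
    simpa [coeffLogWeight] using ((hl1.add hl2).div_const 2).neg
  have h2 := tendsto_coeffPhase μ hN hd0 hd hκ hσ u
  have h3 := (Complex.continuous_exp.tendsto _).comp
    (((Complex.continuous_ofReal.tendsto _).comp h1).add
      (((Complex.continuous_ofReal.tendsto _).comp h2).const_mul Complex.I))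
  refine h3.congr' (Eventually.of_forall fun k => rfl) |>.trans_eq ?_
  congr 2
  push_cast
  ring

/-- The rescaled matrix coefficient integrals converge to the Airy function. -/
theorem tendsto_integral_coeffIntegrand (μ : ℝ) {N κ d : ℕ → ℝ} {σ δ A₀ : ℝ} {G : ℂ → ℂ}
    (hN : Tendsto N atTop atTop) (hd0 : ∀ k, 0 < d k) (hd1 : ∀ k, d k ≤ 1)
    (hd : Tendsto d atTop (𝓝 δ)) (hκ : Tendsto κ atTop (𝓝 1)) (hκ1 : ∀ k, κ k ≤ 1)
    (hA₀ : 0 < A₀) (hA : ∀ᶠ k in atTop, A₀ ≤ κ k - d k ^ 2)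
    (hσ : Tendsto (fun k => N k ^ 2 * (1 - κ k)) atTop (𝓝 σ))
    (hG : Tendsto (fun R : ℝ => ∫ u in (-R)..R,
      Complex.exp (Complex.I * (σ * u - (1 - δ ^ 2 : ℝ) * u ^ 3 / 3))) atTop (𝓝 (G σ))) :
    Tendsto (fun k => ∫ u, coeffIntegrand μ (N k) (κ k) (d k) u) atTop (𝓝 (G σ)) := by
  rw [Metric.tendsto_atTop']
  intro ε hε
  set B : ℝ → ℝ := fun R => 2 * ((8 + 2 * |μ|) / (A₀ * R ^ 2)) with hB
  have hBlim : Tendsto B atTop (𝓝 0) := by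
    have : Tendsto (fun R : ℝ => A₀ * R ^ 2) atTop atTop :=
      (tendsto_pow_atTop two_ne_zero).const_mul_atTop hA₀
    simpa using (tendsto_const_nhds (x := 8 + 2 * |μ|)).div_atTop this |>.const_mul 2
  have hRlim : Tendsto (fun R : ℝ => A₀ * R ^ 2) atTop atTop :=
    (tendsto_pow_atTop two_ne_zero).const_mul_atTop hA₀
  -- `R` makes both tails smaller than `ε / 3`. The bound `2 (σ + 1)` lets the derivative test apply
  -- once `N² (1 - κ) < σ + 1`.
  obtain ⟨R, hR1, hR2, hR3, hR0⟩ := ((hBlim.eventually_lt_const (show 0 < ε / 3 by linarith)).and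
    (((Metric.tendsto_nhds.1 hG) (ε / 3) (by linarith)).and
    ((hRlim.eventually_ge_atTop (2 * (σ + 1))).and (eventually_gt_atTop (0 : ℝ))))).exists
  have htrunc : Tendsto (fun k => ∫ u in (-R)..R, coeffIntegrand μ (N k) (κ k) (d k) u) atTop
      (𝓝 (∫ u in (-R)..R,
        Complex.exp (Complex.I * (σ * u - (1 - δ ^ 2 : ℝ) * u ^ 3 / 3)))) := by
    refine intervalIntegral.tendsto_integral_filter_of_dominated_convergence (fun _ => (1 : ℝ))
      (Eventually.of_forall fun k => (continuous_coeffIntegrand _ _ _ _).aestronglyMeasurable)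
      (Eventually.of_forall fun k => Eventually.of_forall fun u _ =>
        norm_coeffIntegrand_le_one _ _ _ _ _) (by simp)
      (Eventually.of_forall fun u _ => tendsto_coeffIntegrand μ hN hd0 hd hκ hσ u)
  have hev : ∀ᶠ k in atTop, dist (∫ u, coeffIntegrand μ (N k) (κ k) (d k) u) (G σ) < ε := by
    filter_upwards [hA, hN.eventually_ge_atTop R, hσ.eventually_lt_const (lt_add_one σ),
      (Metric.tendsto_nhds.1 htrunc) (ε / 3) (by linarith)] with k hAk hNk hsk htk
    have hR2' : A₀ * R ^ 2 ≤ (κ k - d k ^ 2) * R ^ 2 := by gcongr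
    have h1 := norm_integral_sub_integral_coeffIntegrand_le μ (hd0 k) (hd1 k) (hκ1 k)
      (hA₀.trans_le hAk) hR0 hNk (by linarith)
    rw [← dist_eq_norm] at h1
    have h2 : 2 * ((8 + 2 * |μ|) / ((κ k - d k ^ 2) * R ^ 2)) ≤ B R := by
      simp only [hB]; gcongr
    have h3 := dist_triangle4 (∫ u, coeffIntegrand μ (N k) (κ k) (d k) u)
      (∫ u in (-R)..R, coeffIntegrand μ (N k) (κ k) (d k) u)
      (∫ u in (-R)..R, Complex.exp (Complex.I * (σ * u - (1 - δ ^ 2 : ℝ) * u ^ 3 / 3))) (G σ)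
    linarith
  obtain ⟨K, hK⟩ := eventually_atTop.1 hev
  exact ⟨K, fun k hk => hK k hk.le⟩

/-! ### Matrix coefficients in the rescaled coordinate -/

theorem kType_mul_I (μ : ℝ) (n : ℤ) (x : ℝ) :
    kType (Complex.I * μ) n x = Complex.exp (((-(Real.log (1 + x ^ 2) / 2) : ℝ) : ℂ) +
      Complex.I * ((n * Real.arctan x + μ / 2 * Real.log (1 + x ^ 2) : ℝ) : ℂ)) := by
  have h : (0 : ℝ) < 1 + x ^ 2 := by positivity
  rw [kType, Complex.cpow_def_of_ne_zero (by exact_mod_cast h.ne'), ← Complex.ofReal_log h.le,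
    ← Complex.exp_add]
  congr 1
  push_cast
  ring

/-- The inverse matrix sends `(x, 1)` to `(a x, a⁻¹)`, and homogeneity returns this point to the
line. -/
theorem lineAction_bracket (lam : ℂ) {a : ℝ} (ha : 0 < a) (v : ℝ → ℂ) (x : ℝ) :
    lineAction lam (bracket a) v x = ((a⁻¹ : ℝ) : ℂ) ^ (lam - 1) * v (a ^ 2 * x) := by
  have ha0 : a ≠ 0 := ha.ne'
  have hdet : ((bracket a : GL (Fin 2) ℝ) : Matrix (Fin 2) (Fin 2) ℝ).det = 1 := by
    simp [bracket, ha0, Matrix.GeneralLinearGroup.mkOfDetNeZero, Matrix.det_fin_two]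
  have hinv : (((bracket a)⁻¹ : GL (Fin 2) ℝ) : Matrix (Fin 2) (Fin 2) ℝ) = !![a, 0; 0, a⁻¹] := by
    rw [Matrix.coe_units_inv]
    refine Matrix.inv_eq_right_inv ?_
    simp [bracket, ha0, Matrix.GeneralLinearGroup.mkOfDetNeZero, Matrix.one_fin_two]
  rw [lineAction, planeAction, hdet, hinv, homExt]
  have h1 : a * x / a⁻¹ = a ^ 2 * x := by field_simp
  simp [Matrix.mulVec, dotProduct, Fin.sum_univ_two, h1, abs_of_pos ha]

theorem matrixCoeff_eq (lam : ℂ) (m n : ℤ) {a : ℝ} (ha : 0 < a) :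
    matrixCoeff lam m n a = ((Real.pi⁻¹ : ℝ) : ℂ) * (((a⁻¹ : ℝ) : ℂ) ^ (lam - 1) *
      ∫ x, kType lam m (a ^ 2 * x) * (starRingEnd ℂ) (kType lam n x)) := by
  rw [matrixCoeff, lineInner]
  simp_rw [lineAction_bracket _ ha, mul_assoc]
  rw [integral_const_mul]

/-- The integrand of the matrix coefficient in the coordinate `u = m^{1/3} a² x`. -/
theorem kType_mul_conj_kType (μ : ℝ) {m n : ℕ} {N a : ℝ} (hN : 0 < N) (hNm : N ^ 3 = m)
    (hm : 0 < m) (ha : 0 < a) (u : ℝ) :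
    kType (Complex.I * μ) m (a ^ 2 * ((N * a ^ 2)⁻¹ * u)) *
      (starRingEnd ℂ) (kType (Complex.I * μ) n ((N * a ^ 2)⁻¹ * u)) =
      coeffIntegrand μ N ((n / m) / a ^ 2) ((a ^ 2)⁻¹) u := by
  have h1 : a ^ 2 * ((N * a ^ 2)⁻¹ * u) = u / N := by field_simp
  have h2 : (N * a ^ 2)⁻¹ * u = (a ^ 2)⁻¹ * (u / N) := by field_simp
  have hm' : (m : ℝ) ≠ 0 := by exact_mod_cast hm.ne'
  rw [h1, h2, kType_mul_I, kType_mul_I, ← Complex.exp_conj, ← Complex.exp_add, coeffIntegrand]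
  congr 1
  have h3 : N ^ 3 * ((n : ℝ) / m / a ^ 2 / (a ^ 2)⁻¹) = n := by rw [hNm]; field_simp
  rw [coeffPhase, mul_sub, ← mul_assoc (N ^ 3), h3, hNm, coeffLogWeight]
  simp only [map_add, map_mul, Complex.conj_ofReal, Complex.conj_I]
  push_cast
  ring

/-- The Jacobian is `N a²`; for imaginary `lam` the factor `(a⁻¹)^(lam - 1)` has modulus `a`,
leaving `N a`. -/
theorem norm_matrixCoeff (μ : ℝ) {m n : ℕ} {N a : ℝ} (hN : 0 < N) (hNm : N ^ 3 = m)
    (hm : 0 < m) (ha : 0 < a) :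
    Real.pi * N * a * ‖matrixCoeff (Complex.I * μ) m n a‖ =
      ‖∫ u, coeffIntegrand μ N ((n / m) / a ^ 2) ((a ^ 2)⁻¹) u‖ := by
  have h1 : ∫ u, coeffIntegrand μ N ((n / m) / a ^ 2) ((a ^ 2)⁻¹) u = (N * a ^ 2 : ℝ) •
      ∫ x, kType (Complex.I * μ) m (a ^ 2 * x) * (starRingEnd ℂ) (kType (Complex.I * μ) n x) := by
    simp_rw [← kType_mul_conj_kType μ hN hNm hm ha]
    rw [Measure.integral_comp_mul_left (fun x : ℝ => kType (Complex.I * μ) m (a ^ 2 * x) *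
      (starRingEnd ℂ) (kType (Complex.I * μ) n x)), inv_inv, abs_of_pos (by positivity)]
  have h3 : ‖((a⁻¹ : ℝ) : ℂ) ^ (Complex.I * μ - 1)‖ = a := by
    rw [Complex.norm_cpow_eq_rpow_re_of_pos (by positivity)]
    simp [Real.rpow_neg_one]
  rw [h1, matrixCoeff_eq _ _ _ ha, norm_smul, norm_mul, norm_mul, h3, Complex.norm_real, Real.norm_of_nonneg
    (by positivity), Real.norm_of_nonneg (by positivity)]
  have := Real.pi_pos
  field_simp

theorem norm_kType (μ : ℝ) (n : ℤ) (x : ℝ) :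
    ‖kType (Complex.I * μ) n x‖ = Real.exp (-(Real.log (1 + x ^ 2) / 2)) := by
  rw [kType_mul_I, Complex.norm_exp, Complex.add_re, Complex.ofReal_re, mul_comm Complex.I,
    Complex.re_ofReal_mul, Complex.I_re, mul_zero, add_zero]

theorem continuous_kType (μ : ℝ) (n : ℤ) : Continuous (kType (Complex.I * μ) n) := by
  have : kType (Complex.I * μ) n = fun x => _ := funext (kType_mul_I μ n)
  rw [this]
  have h : ∀ x : ℝ, 1 + x ^ 2 ≠ 0 := fun x => by positivity
  have := Real.continuous_arctan
  fun_prop (disch := assumption)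

/-- Matrix coefficients are continuous on `A⁻`. -/
theorem continuousOn_matrixCoeff (μ : ℝ) (m n : ℤ) :
    ContinuousOn (matrixCoeff (Complex.I * μ) m n) (Ici 1) := by
  have h1 : ContinuousOn (fun a : ℝ => ((Real.pi⁻¹ : ℝ) : ℂ) *
      (((a⁻¹ : ℝ) : ℂ) ^ (Complex.I * μ - 1) *
      ∫ x, kType (Complex.I * μ) m (a ^ 2 * x) *
        (starRingEnd ℂ) (kType (Complex.I * μ) n x))) (Ici 1) := by
    refine continuousOn_const.mul (ContinuousOn.mul ?_ ?_)
    · intro a ha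
      have ha0 : (0 : ℝ) < a := lt_of_lt_of_le one_pos ha
      refine ContinuousAt.continuousWithinAt ?_
      refine ContinuousAt.cpow ?_ continuousAt_const ?_
      · exact Complex.continuous_ofReal.continuousAt.comp (continuousAt_inv₀ ha0.ne')
      · rw [Complex.ofReal_mem_slitPlane]; positivity
    · refine continuousOn_of_dominated (bound := fun x => (1 + x ^ 2)⁻¹) ?_ ?_
        integrable_inv_one_add_sq ?_
      · intro a _
        have h1 := (continuous_kType μ m).comp (continuous_const_mul (a ^ 2))
        exact (h1.mul (Complex.continuous_conj.comp (continuous_kType μ n))).aestronglyMeasurable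
      · intro a ha
        refine Eventually.of_forall fun x => ?_
        rw [norm_mul, RCLike.norm_conj, norm_kType, norm_kType, ← Real.exp_add]
        have hx : (0 : ℝ) < 1 + x ^ 2 := by positivity
        have h2 : Real.log (1 + x ^ 2) ≤ Real.log (1 + (a ^ 2 * x) ^ 2) := by
          refine Real.log_le_log hx ?_
          have : 1 ≤ a ^ 2 := one_le_pow₀ ha
          have h4 : 1 ≤ (a ^ 2) ^ 2 := one_le_pow₀ this
          rw [mul_pow]
          nlinarith [sq_nonneg x]
        calc _ ≤ Real.exp (-Real.log (1 + x ^ 2)) := Real.exp_le_exp.2 (by linarith)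
          _ = _ := by rw [Real.exp_neg, Real.exp_log hx]
      · refine Eventually.of_forall fun x => Continuous.continuousOn ?_
        have h1 := (continuous_kType μ m).comp
          (show Continuous fun a : ℝ => a ^ 2 * x by fun_prop)
        exact h1.mul continuous_const
  refine h1.congr fun a ha => ?_
  have ha0 : (0 : ℝ) < a := lt_of_lt_of_le one_pos ha
  exact matrixCoeff_eq _ _ _ ha0

/-! ### Mean-square lower bound by compactness -/

/-- An entire function vanishing on a real segment vanishes identically. -/
theorem entire_eq_zero_of_eq_zero_on_segment {G : ℂ → ℂ} (hG : Differentiable ℂ G) {a b : ℝ}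
    (hab : a < b) (h : ∀ t ∈ Icc a b, G (t : ℝ) = 0) (z : ℂ) : G z = 0 := by
  refine (hG.differentiableOn (s := univ)).analyticOnNhd isOpen_univ
    |>.eqOn_zero_of_preconnected_of_frequently_eq_zero isPreconnected_univ (mem_univ (a : ℂ)) ?_
    (mem_univ z)
  have h1 : Tendsto (fun t : ℝ => (t : ℂ)) (𝓝[>] a) (𝓝[≠] (a : ℂ)) := by
    refine tendsto_nhdsWithin_of_tendsto_nhds_of_eventually_within _
      (Complex.continuous_ofReal.continuousAt.mono_left nhdsWithin_le_nhds) ?_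
    filter_upwards [self_mem_nhdsWithin] with t ht
    simpa using (ne_of_gt ht)
  refine h1.frequently (Eventually.frequently ?_)
  filter_upwards [Ioc_mem_nhdsGT hab] with t ht
  exact h t ⟨ht.1.le, ht.2⟩

/-- An entire function that does not vanish at the origin has positive mean square on every
segment `[τ / 2, 3 τ / 2]`, including `τ = 0`. -/
theorem integral_norm_sq_entire_pos {G : ℂ → ℂ} (hG : Differentiable ℂ G) (hG0 : G 0 ≠ 0)
    {τ : ℝ} (hτ : 0 ≤ τ) : 0 < ∫ t in (1 / 4 : ℝ)..(3 / 4), ‖G ((2 * t * τ : ℝ) : ℂ)‖ ^ 2 := by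
  refine intervalIntegral.integral_pos (by norm_num) ?_ (fun _ _ => by positivity) ?_
  · have := hG.continuous
    fun_prop
  by_contra! hcon
  have hz : ∀ t ∈ Icc (1 / 4 : ℝ) (3 / 4), G ((2 * t * τ : ℝ) : ℂ) = 0 := by
    intro t ht
    have := le_antisymm (hcon t ht) (by positivity)
    simpa using this
  rcases hτ.eq_or_lt with h0 | h0
  · apply hG0
    have := hz (1 / 2) ⟨by norm_num, by norm_num⟩
    simpa [← h0] using this
  · refine hG0 (entire_eq_zero_of_eq_zero_on_segment hG (a := τ / 2) (b := 3 * τ / 2)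
      (by linarith) (fun s hs => ?_) 0)
    have h1 := hz (s / (2 * τ)) ⟨by
      rw [le_div_iff₀ (by positivity)]; linarith [hs.1], by
      rw [div_le_iff₀ (by positivity)]; linarith [hs.2]⟩
    rwa [show 2 * (s / (2 * τ)) * τ = s by field_simp] at h1

theorem one_sub_inv_sq_one_add_le {x : ℝ} (hx : 0 ≤ x) : 1 - ((1 + x) ^ 2)⁻¹ ≤ 2 * x := by
  have h : 0 < (1 + x) ^ 2 := by positivity
  have : 1 - 2 * x ≤ ((1 + x) ^ 2)⁻¹ := by
    rw [← one_div, le_div_iff₀ h]; nlinarith [mul_nonneg hx hx, mul_nonneg hx (mul_nonneg hx hx)]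
  linarith

/-- The discriminant of the rescaled phase is bounded below on the shell. -/
theorem le_kappa_sub_sq {δ₀ δ x : ℝ} (hδ : 0 ≤ δ) (hδδ : δ ≤ δ₀) (hδ0 : δ₀ < 1) (hx : 0 ≤ x)
    (hx1 : x ≤ 1) :
    (1 - δ₀ ^ 2) / 4 ≤ ((1 + x) ^ 2)⁻¹ - (δ * ((1 + x) ^ 2)⁻¹) ^ 2 := by
  set κ := ((1 + x) ^ 2)⁻¹ with hκ
  have h1 : 1 / 4 ≤ κ := by
    rw [hκ, ← one_div]; exact one_div_le_one_div_of_le (by positivity) (by nlinarith)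
  have h2 : κ ≤ 1 := inv_le_one_of_one_le₀ (by nlinarith)
  have h3 : δ ^ 2 ≤ δ₀ ^ 2 := by gcongr
  have h4 : κ ^ 2 ≤ κ := by nlinarith
  have h6 : 0 ≤ 1 - δ₀ ^ 2 := by nlinarith
  calc (1 - δ₀ ^ 2) / 4 = (1 - δ₀ ^ 2) * (1 / 4) := by ring
    _ ≤ (1 - δ₀ ^ 2) * κ := by gcongr
    _ ≤ κ - δ ^ 2 * κ ^ 2 := by nlinarith [mul_le_mul h3 h4 (sq_nonneg κ) (sq_nonneg δ₀)]
    _ = _ := by ring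

/-- The mean square of the rescaled Airy integrals over the shell is bounded below. -/
theorem exists_le_integral_norm_sq_coeffIntegral (μ : ℝ) {δ₀ : ℝ} (hδ₀ : δ₀ < 1) :
    ∃ N₀ : ℝ, ∃ c : ℝ, 0 < c ∧ ∀ N δ ε : ℝ, N₀ ≤ N → 0 < δ → δ ≤ δ₀ → 0 < ε → ε * N ^ 2 ≤ 1 →
      (ContinuousOn (fun t : ℝ => ‖∫ u, coeffIntegrand μ N ((1 + ε * t) ^ 2)⁻¹
        (δ * ((1 + ε * t) ^ 2)⁻¹) u‖) (Icc (1 / 4) (3 / 4))) →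
      c ≤ ∫ t in (1 / 4 : ℝ)..(3 / 4), ‖∫ u, coeffIntegrand μ N ((1 + ε * t) ^ 2)⁻¹
        (δ * ((1 + ε * t) ^ 2)⁻¹) u‖ ^ 2 := by
  -- If no pair `(N₀, c)` works, the pairs `(k + 1, 1/(k + 1))` give counterexamples with `N → ∞`
  -- and mean squares tending to `0`.
  by_contra! hcon
  choose N δ ε hNk hδ hδ1 hε hεN hcont hlt using
    fun k : ℕ => hcon (k + 1) (1 / ((k : ℝ) + 1)) (by positivity)
  have hτmem : ∀ k, (ε k * N k ^ 2, δ k) ∈ Icc (0 : ℝ) 1 ×ˢ Icc (0 : ℝ) δ₀ := fun k =>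
    ⟨⟨mul_nonneg (hε k).le (sq_nonneg _), hεN k⟩, (hδ k).le, hδ1 k⟩
  -- Along a subsequence `ε N² → τ` and `δ → δ' ≤ δ₀ < 1`; the limiting Airy parameter at `t` is `2
  -- t τ`. The case `τ = 0` may occur.
  obtain ⟨⟨τ, δ'⟩, ⟨⟨hτ0, _⟩, hδ'0, hδ'1⟩, φ, hφ, hlim⟩ :=
    (isCompact_Icc.prod isCompact_Icc).tendsto_subseq hτmem
  have hτlim : Tendsto (fun k => ε (φ k) * N (φ k) ^ 2) atTop (𝓝 τ) :=
    (continuous_fst.tendsto _).comp hlim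
  have hδlim : Tendsto (fun k => δ (φ k)) atTop (𝓝 δ') := (continuous_snd.tendsto _).comp hlim
  simp only at hτ0 hδ'0 hδ'1
  have hq : 0 < 1 - δ' ^ 2 := by nlinarith
  obtain ⟨G, hGd, hG0, hG⟩ := exists_entire_airy hq
  have hk1 : ∀ k : ℕ, (k : ℝ) + 1 ≤ N (φ k) := fun k => by
    have h : (k : ℝ) ≤ φ k := by exact_mod_cast hφ.le_apply
    linarith [hNk (φ k)]
  have hNlim : Tendsto (fun k => N (φ k)) atTop atTop :=
    tendsto_atTop_mono hk1 (tendsto_atTop_add_const_right _ _ tendsto_natCast_atTop_atTop)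
  have hN1 : ∀ k, 1 ≤ N (φ k) := fun k => by
    have := hk1 k; have : (0 : ℝ) ≤ k := k.cast_nonneg; linarith
  have hε1 : ∀ k, ε (φ k) ≤ 1 := fun k => by
    have h1 : 1 ≤ N (φ k) ^ 2 := one_le_pow₀ (hN1 k)
    nlinarith [hεN (φ k), hε (φ k)]
  have hεlim : Tendsto (fun k => ε (φ k)) atTop (𝓝 0) := by
    have h1 : Tendsto (fun k => ε (φ k) * N (φ k) ^ 2 / N (φ k) ^ 2) atTop (𝓝 0) :=
      hτlim.div_atTop ((tendsto_pow_atTop two_ne_zero).comp hNlim)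
    refine h1.congr fun k => ?_
    have := hN1 k
    field_simp
  set A₀ := (1 - δ₀ ^ 2) / 4 with hA₀
  have hA₀0 : 0 < A₀ := by
    have : 0 ≤ δ₀ := hδ'0.trans hδ'1
    rw [hA₀]; nlinarith
  set F : ℕ → ℝ → ℝ := fun k t => ‖∫ u, coeffIntegrand μ (N (φ k)) ((1 + ε (φ k) * t) ^ 2)⁻¹
        (δ (φ k) * ((1 + ε (φ k) * t) ^ 2)⁻¹) u‖ with hF
  have hκ1 : ∀ k t, 0 ≤ t → ((1 + ε (φ k) * t) ^ 2)⁻¹ ≤ 1 := fun k t ht => by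
    have : 0 ≤ ε (φ k) * t := mul_nonneg (hε _).le ht
    exact inv_le_one_of_one_le₀ (one_le_pow₀ (by linarith))
  have hd0 : ∀ k t, 0 ≤ t → 0 < δ (φ k) * ((1 + ε (φ k) * t) ^ 2)⁻¹ := fun k t ht => by
    have : 0 ≤ ε (φ k) * t := mul_nonneg (hε _).le ht
    have := hδ (φ k)
    positivity
  have hd1 : ∀ k t, 0 ≤ t → δ (φ k) * ((1 + ε (φ k) * t) ^ 2)⁻¹ ≤ 1 := fun k t ht =>
    mul_le_one₀ ((hδ1 _).trans hδ₀.le) (by positivity) (hκ1 k t ht)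
  have hA : ∀ k t, 0 ≤ t → t ≤ 1 → A₀ ≤ ((1 + ε (φ k) * t) ^ 2)⁻¹ -
      (δ (φ k) * ((1 + ε (φ k) * t) ^ 2)⁻¹) ^ 2 := fun k t ht ht1 =>
    le_kappa_sub_sq (hδ _).le (hδ1 _) hδ₀ (mul_nonneg (hε _).le ht)
      (mul_le_one₀ (hε1 k) ht ht1)
  have hs : ∀ k t, 0 ≤ t → t ≤ 1 → N (φ k) ^ 2 * (1 - ((1 + ε (φ k) * t) ^ 2)⁻¹) ≤ 2 := by
    intro k t ht ht1
    have h1 := one_sub_inv_sq_one_add_le (mul_nonneg (hε (φ k)).le ht)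
    have h2 : N (φ k) ^ 2 * (1 - ((1 + ε (φ k) * t) ^ 2)⁻¹) ≤ N (φ k) ^ 2 * (2 * (ε (φ k) * t)) := by
      gcongr
    have h3 := hεN (φ k)
    have h4 : 0 ≤ ε (φ k) * N (φ k) ^ 2 := (hτmem (φ k)).1.1
    nlinarith
  have hpt : ∀ t, 0 ≤ t → t ≤ 1 → Tendsto (fun k => F k t) atTop
      (𝓝 ‖G ((2 * t * τ : ℝ) : ℂ)‖) := by
    intro t ht ht1
    have h1 : Tendsto (fun k => 1 + ε (φ k) * t) atTop (𝓝 1) := by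
      simpa using (hεlim.mul_const t).const_add 1
    have hκlim : Tendsto (fun k => ((1 + ε (φ k) * t) ^ 2)⁻¹) atTop (𝓝 1) := by
      simpa using (h1.pow 2).inv₀ (by norm_num)
    have hdlim : Tendsto (fun k => δ (φ k) * ((1 + ε (φ k) * t) ^ 2)⁻¹) atTop (𝓝 δ') := by
      simpa using hδlim.mul hκlim
    have hσ : Tendsto (fun k => N (φ k) ^ 2 * (1 - ((1 + ε (φ k) * t) ^ 2)⁻¹)) atTop
        (𝓝 (2 * t * τ)) := by
      have h2 : Tendsto (fun k => (ε (φ k) * N (φ k) ^ 2) * (t * (2 + ε (φ k) * t)) *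
          ((1 + ε (φ k) * t) ^ 2)⁻¹) atTop (𝓝 (τ * (t * (2 + 0 * t)) * 1)) :=
        (hτlim.mul (((hεlim.mul_const t).const_add 2).const_mul t)).mul hκlim
      refine (h2.congr fun k => ?_).trans_eq (by congr 1; ring)
      have : 0 < 1 + ε (φ k) * t := by have := mul_nonneg (hε (φ k)).le ht; linarith
      field_simp
      ring
    exact (tendsto_integral_coeffIntegrand μ hNlim (hd0 · t ht) (hd1 · t ht) hdlim hκlim
      (hκ1 · t ht) hA₀0 (Eventually.of_forall (hA · t ht ht1)) hσ
      (by simpa using hG (2 * t * τ))).norm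
  -- The value `4` is twice the bound `N² (1 - κ) ≤ 2`, as the tail estimate requires uniformly in
  -- `t`.
  obtain ⟨R, hR, hR0⟩ := (((tendsto_pow_atTop two_ne_zero).const_mul_atTop hA₀0
    |>.eventually_ge_atTop 4).and (eventually_gt_atTop (0 : ℝ))).exists
  have hlimint : Tendsto (fun k => ∫ t in (1 / 4 : ℝ)..(3 / 4), F k t ^ 2) atTop
      (𝓝 (∫ t in (1 / 4 : ℝ)..(3 / 4), ‖G ((2 * t * τ : ℝ) : ℂ)‖ ^ 2)) := by
    have huIoc : uIoc (1 / 4 : ℝ) (3 / 4) = Ioc (1 / 4) (3 / 4) := uIoc_of_le (by norm_num)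
    refine intervalIntegral.tendsto_integral_filter_of_dominated_convergence
      (fun _ => (2 * ((8 + 2 * |μ|) / (A₀ * R ^ 2)) + 2 * R) ^ 2)
      (Eventually.of_forall fun k => ?_) ?_ (by simp) (Eventually.of_forall fun t ht => ?_)
    · rw [huIoc]
      exact (((hcont (φ k)).mono Ioc_subset_Icc_self).pow 2).aestronglyMeasurable measurableSet_Ioc
    · filter_upwards [hNlim.eventually_ge_atTop R] with k hk
      refine Eventually.of_forall fun t ht => ?_
      rw [huIoc] at ht
      have ht0 : 0 ≤ t := by linarith [ht.1]
      have ht1 : t ≤ 1 := by linarith [ht.2]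
      have hAk := hA k t ht0 ht1
      have hAR := mul_le_mul_of_nonneg_right hAk (sq_nonneg R)
      rw [Real.norm_of_nonneg (by positivity)]
      refine pow_le_pow_left₀ (norm_nonneg _) ?_ 2
      refine (norm_integral_coeffIntegrand_le_of_le μ (hd0 k t ht0) (hd1 k t ht0) (hκ1 k t ht0)
        (hA₀0.trans_le hAk) hR0 hk (by linarith [hs k t ht0 ht1])).trans ?_
      gcongr
    · rw [huIoc] at ht
      exact (hpt t (by linarith [ht.1]) (by linarith [ht.2])).pow 2
  have hzero : Tendsto (fun k => 1 / ((φ k : ℝ) + 1)) atTop (𝓝 0) :=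
    tendsto_one_div_add_atTop_nhds_zero_nat.comp hφ.tendsto_atTop
  have hle := le_of_tendsto_of_tendsto' hlimint hzero fun k => (hlt (φ k)).le
  exact absurd hle (not_le.2 (integral_norm_sq_entire_pos hGd hG0 hτ0))

/-! ### Cartan density, cutoff and conclusion -/

theorem cartanDensity_nonneg {a : ℝ} (ha : 1 ≤ a) : 0 ≤ cartanDensity a := by
  have h1 : 1 ≤ a ^ 2 := one_le_pow₀ ha
  have h2 : (a ^ 2)⁻¹ ≤ 1 := inv_le_one_of_one_le₀ h1
  have h3 : 0 ≤ a⁻¹ := by positivity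
  exact mul_nonneg (by linarith) h3

/-- The density equals `(1 - a⁻⁴) a / 2`. For `T₀ > 1` the constant is positive, so the density is
at least a fixed multiple of `a`. -/
theorem le_cartanDensity {a T₀ : ℝ} (hT₀ : 0 < T₀) (ha : T₀ ≤ a) :
    (1 - (T₀ ^ 2)⁻¹ ^ 2) / 2 * a ≤ cartanDensity a := by
  have ha0 : 0 < a := hT₀.trans_le ha
  have h1 : (a ^ 2)⁻¹ ≤ (T₀ ^ 2)⁻¹ := by gcongr
  have h2 : (a ^ 2)⁻¹ ^ 2 ≤ (T₀ ^ 2)⁻¹ ^ 2 := by gcongr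
  have h3 : cartanDensity a = (1 - (a ^ 2)⁻¹ ^ 2) / 2 * a := by
    unfold cartanDensity; field_simp
  rw [h3]; gcongr

theorem continuousOn_integrand_integratedCoeff (μ : ℝ) (m n : ℤ) {α₁ : ℝ → ℝ}
    (hα : IsCutoffProfile α₁) (ε T : ℝ) :
    ContinuousOn (fun a => ‖matrixCoeff (Complex.I * μ) m n a‖ ^ 2 * shellCutoff α₁ ε T a *
      cartanDensity a) (Ici 1) := by
  have h0 : ∀ a ∈ Ici (1 : ℝ), a ≠ 0 := fun a ha => (lt_of_lt_of_le one_pos ha).ne'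
  have h1 : Continuous (shellCutoff α₁ ε T) := by
    have := hα.smooth.continuous
    unfold shellCutoff
    fun_prop
  have h2 : ContinuousOn cartanDensity (Ici 1) := by
    unfold cartanDensity
    refine ContinuousOn.mul (ContinuousOn.div_const (ContinuousOn.sub (by fun_prop)
      (ContinuousOn.inv₀ (by fun_prop) fun a ha => pow_ne_zero 2 (h0 a ha))) _)
      (continuousOn_id.inv₀ h0)
  exact (((continuousOn_matrixCoeff μ m n).norm.pow 2).mul h1.continuousOn).mul h2

theorem shellCutoff_eq_zero {α₁ : ℝ → ℝ} (hα : IsCutoffProfile α₁) {ε T a : ℝ} (hε : 0 < ε)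
    (hT : 0 < T) (ha : T * (1 + ε) < a) : shellCutoff α₁ ε T a = 0 := by
  unfold shellCutoff
  refine image_eq_zero_of_notMem_tsupport fun h => ?_
  have h1 := (hα.support_subset h).2
  rw [inv_mul_le_iff₀ hε, mul_one] at h1
  have h2 : T⁻¹ * a ≤ 1 + ε := by linarith
  rw [inv_mul_le_iff₀ hT] at h2
  linarith

theorem integrableOn_integratedCoeff (μ : ℝ) (m n : ℤ) {α₁ : ℝ → ℝ} (hα : IsCutoffProfile α₁)
    {ε T : ℝ} (hε : 0 < ε) (hT : 0 < T) :
    IntegrableOn (fun a => ‖matrixCoeff (Complex.I * μ) m n a‖ ^ 2 * shellCutoff α₁ ε T a *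
      cartanDensity a) (Ici 1) := by
  have h1 := ((continuousOn_integrand_integratedCoeff μ m n hα ε T).mono
    (Icc_subset_Ici_self : Icc 1 (T * (1 + ε)) ⊆ Ici 1)).integrableOn_compact (μ := volume) isCompact_Icc
  refine h1.of_forall_sdiff_eq_zero measurableSet_Ici fun a ha => ?_
  have h2 : T * (1 + ε) < a := by
    by_contra! h
    exact ha.2 ⟨ha.1, h⟩
  rw [shellCutoff_eq_zero hα hε hT h2]; ring

/-- The integrated coefficient dominates the integral over the plateau of the cutoff. -/
theorem integral_plateau_le_integratedCoeff (μ : ℝ) (m n : ℤ) {α₁ : ℝ → ℝ}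
    (hα : IsCutoffProfile α₁) {ε T : ℝ} (hε : 0 < ε) (hT : 1 ≤ T) :
    T * ε * ∫ t in (1 / 4 : ℝ)..(3 / 4), ‖matrixCoeff (Complex.I * μ) m n (T * (1 + ε * t))‖ ^ 2 *
      cartanDensity (T * (1 + ε * t)) ≤
      integratedCoeff (Complex.I * μ) m n (shellCutoff α₁ ε T) := by
  have hT0 : 0 < T := one_pos.trans_le hT
  set g : ℝ → ℝ := fun a => ‖matrixCoeff (Complex.I * μ) m n a‖ ^ 2 * shellCutoff α₁ ε T a *
    cartanDensity a with hg
  have hsub := intervalIntegral.integral_comp_mul_add (a := 1 / 4) (b := 3 / 4) g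
    (mul_pos hT0 hε).ne' T
  have hcongr : ∫ t in (1 / 4 : ℝ)..(3 / 4),
      ‖matrixCoeff (Complex.I * μ) m n (T * (1 + ε * t))‖ ^ 2 * cartanDensity (T * (1 + ε * t)) =
      ∫ t in (1 / 4 : ℝ)..(3 / 4), g (T * ε * t + T) := by
    refine intervalIntegral.integral_congr fun t ht => ?_
    rw [uIcc_of_le (by norm_num)] at ht
    have h1 : shellCutoff α₁ ε T (T * (1 + ε * t)) = 1 := by
      unfold shellCutoff
      rw [show ε⁻¹ * (T⁻¹ * (T * (1 + ε * t)) - 1) = t by field_simp; ring]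
      exact hα.eq_one t ht
    simp only [hg]
    rw [show T * ε * t + T = T * (1 + ε * t) by ring, h1, mul_one]
  have hle : T * ε * (1 / 4) + T ≤ T * ε * (3 / 4) + T := by
    have := mul_pos hT0 hε; linarith
  rw [hcongr, hsub, smul_eq_mul, mul_inv_cancel_left₀ (mul_pos hT0 hε).ne',
    intervalIntegral.integral_of_le hle]
  refine setIntegral_mono_set (integrableOn_integratedCoeff μ m n hα hε hT0) ?_
    (LE.le.eventuallyLE fun a ha => ?_)
  · refine (ae_restrict_mem measurableSet_Ici).mono fun a ha => ?_
    exact mul_nonneg (mul_nonneg (sq_nonneg _) (hα.nonneg _)) (cartanDensity_nonneg ha)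
  · have := mul_pos hT0 hε
    have := ha.1
    change 1 ≤ a
    linarith

/-- Taking `0 < ε` loses nothing: at `ε = 0` the convention `0⁻¹ = 0` makes the cutoff the constant
`α₁ 0 = 0`, and both sides vanish. -/
theorem mainTheorem5 (lam : ℂ) (hlam : lam.re = 0) (T₀ : ℝ) (hT₀ : 1 < T₀) :
    ∃ m₀ : ℕ, ∀ α₁ : ℝ → ℝ, IsCutoffProfile α₁ →
      ∃ c : ℝ, 0 < c ∧ ∀ (m n : ℕ) (T ε : ℝ), 0 < m → 0 < n → m₀ ≤ m →
        T = Real.sqrt ((n : ℝ) / m) → T₀ ≤ T → 0 < ε → AiryCondition n T ε →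
          c * ε * (n : ℝ) ^ (-(2 / 3) : ℝ) * T ^ (4 / 3 : ℝ) ≤
            integratedCoeff lam m n (shellCutoff α₁ ε T) := by
  obtain ⟨μ, rfl⟩ : ∃ μ : ℝ, lam = Complex.I * μ :=
    ⟨lam.im, by apply Complex.ext <;> simp [hlam]⟩
  have hT₀0 : 0 < T₀ := one_pos.trans hT₀
  set δ₀ := (T₀ ^ 2)⁻¹ with hδ₀
  have hδ₀0 : 0 < δ₀ := by positivity
  have hδ₀1 : δ₀ < 1 := inv_lt_one_of_one_lt₀ (one_lt_pow₀ hT₀ two_ne_zero)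
  obtain ⟨N₀, c, hc, H⟩ := exists_le_integral_norm_sq_coeffIntegral μ hδ₀1
  have hgap : 0 < 1 - δ₀ ^ 2 := by nlinarith
  -- The threshold on `m = N³` ensures `N ≥ N₀`. Only the plateau of `α₁` is used, so the constant
  -- does not depend on the profile.
  refine ⟨⌈|N₀| ^ 3⌉₊, fun α₁ hα => ⟨c * (1 - δ₀ ^ 2) / (4 * Real.pi ^ 2), by
    have := Real.pi_pos; positivity, ?_⟩⟩
  intro m n T ε hm hn hm₀ hTdef hT₀T hε hAiry
  have hm' : (0 : ℝ) < m := by exact_mod_cast hm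
  have hn' : (0 : ℝ) < n := by exact_mod_cast hn
  have hT1 : 1 ≤ T := hT₀.le.trans hT₀T
  have hT0 : 0 < T := one_pos.trans_le hT1
  have hT2 : T ^ 2 = n / m := by rw [hTdef, Real.sq_sqrt (by positivity)]
  have hnT : (n : ℝ) / T ^ 2 = m := by rw [hT2]; field_simp
  set N : ℝ := (m : ℝ) ^ (1 / 3 : ℝ) with hNdef
  have hN : 0 < N := Real.rpow_pos_of_pos hm' _
  have hN3 : N ^ 3 = m := by
    rw [hNdef, ← Real.rpow_natCast, ← Real.rpow_mul hm'.le]; norm_num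
  have hmN : (m : ℝ) ^ (-(2 / 3) : ℝ) = (N ^ 2)⁻¹ := by
    rw [← hN3, ← Real.rpow_natCast, ← Real.rpow_natCast, ← Real.rpow_mul hN.le,
      ← Real.rpow_neg hN.le]
    norm_num
  have hN₀ : N₀ ≤ N := by
    refine (le_abs_self _).trans (le_of_pow_le_pow_left₀ three_ne_zero hN.le ?_)
    rw [hN3]
    exact (Nat.le_ceil _).trans (by exact_mod_cast hm₀)
  obtain ⟨_, hεle, _⟩ := hAiry
  rw [hnT, hmN] at hεle
  have hεN : ε * N ^ 2 ≤ 1 := by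
    rwa [← le_div_iff₀ (by positivity), one_div]
  have hN1 : 1 ≤ N := Real.one_le_rpow (by exact_mod_cast hm) (by norm_num)
  have hε1 : ε ≤ 1 := hεle.trans (inv_le_one_of_one_le₀ (one_le_pow₀ hN1))
  have ha1 : ∀ t : ℝ, 0 ≤ t → T ≤ T * (1 + ε * t) := fun t ht =>
    le_mul_of_one_le_right hT0.le (by have := mul_nonneg hε.le ht; linarith)
  set M : ℝ → ℝ := fun t => ‖matrixCoeff (Complex.I * μ) m n (T * (1 + ε * t))‖ with hM
  have hMeq : ∀ t : ℝ, 0 ≤ t → ‖∫ u, coeffIntegrand μ N ((1 + ε * t) ^ 2)⁻¹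
      ((T ^ 2)⁻¹ * ((1 + ε * t) ^ 2)⁻¹) u‖ = Real.pi * N * (T * (1 + ε * t)) * M t := by
    intro t ht
    have h1 : 0 < 1 + ε * t := by have := mul_nonneg hε.le ht; linarith
    rw [hM, norm_matrixCoeff μ hN hN3 hm (by positivity), ← hT2, mul_pow, mul_inv]
    rw [show T ^ 2 / (T ^ 2 * (1 + ε * t) ^ 2) = ((1 + ε * t) ^ 2)⁻¹ by field_simp]
  have hMc : ContinuousOn M (Icc (1 / 4) (3 / 4)) := by
    refine ((continuousOn_matrixCoeff μ m n).comp
      (f := fun t : ℝ => T * (1 + ε * t)) (by fun_prop) fun t ht => ?_).norm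
    exact hT1.trans (ha1 t (by linarith [ht.1]))
  have hcont : ContinuousOn (fun t : ℝ => ‖∫ u, coeffIntegrand μ N ((1 + ε * t) ^ 2)⁻¹
      ((T ^ 2)⁻¹ * ((1 + ε * t) ^ 2)⁻¹) u‖) (Icc (1 / 4) (3 / 4)) := by
    refine ContinuousOn.congr (f := fun t => Real.pi * N * (T * (1 + ε * t)) * M t) ?_
      fun t ht => hMeq t (by linarith [ht.1])
    exact ContinuousOn.mul (by fun_prop) hMc
  have hmain := H N (T ^ 2)⁻¹ ε hN₀ (by positivity) (by rw [hδ₀]; gcongr) hε hεN hcont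
  have hρc : ContinuousOn (fun t : ℝ => cartanDensity (T * (1 + ε * t))) (Icc (1 / 4) (3 / 4)) := by
    have h0 : ∀ t ∈ Icc (1 / 4 : ℝ) (3 / 4), T * (1 + ε * t) ≠ 0 := fun t ht =>
      (hT0.trans_le (ha1 t (by linarith [ht.1]))).ne'
    unfold cartanDensity
    exact ContinuousOn.mul (ContinuousOn.div_const (ContinuousOn.sub (by fun_prop)
      (ContinuousOn.inv₀ (by fun_prop) fun t ht => pow_ne_zero 2 (h0 t ht))) _)
      (ContinuousOn.inv₀ (by fun_prop) h0)
  -- This combines `ρ(a) ≥ (1 - δ₀²) a / 2`, the squared normalization `(π N a)²` and `a ≤ 2T`.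
  set K := (1 - δ₀ ^ 2) / (4 * Real.pi ^ 2 * N ^ 2 * T) with hK
  have hint : K * ∫ t in (1 / 4 : ℝ)..(3 / 4), ‖∫ u, coeffIntegrand μ N ((1 + ε * t) ^ 2)⁻¹
      ((T ^ 2)⁻¹ * ((1 + ε * t) ^ 2)⁻¹) u‖ ^ 2 ≤
      ∫ t in (1 / 4 : ℝ)..(3 / 4), M t ^ 2 * cartanDensity (T * (1 + ε * t)) := by
    rw [← intervalIntegral.integral_const_mul]
    refine intervalIntegral.integral_mono_on (by norm_num) ?_ ?_ fun t ht => ?_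
    · refine ContinuousOn.intervalIntegrable ?_
      rw [uIcc_of_le (by norm_num)]
      exact continuousOn_const.mul (hcont.pow 2)
    · refine ContinuousOn.intervalIntegrable ?_
      rw [uIcc_of_le (by norm_num)]
      exact (hMc.pow 2).mul hρc
    · have ht0 : 0 ≤ t := by linarith [ht.1]
      have hTa := ha1 t ht0
      have haT : T * (1 + ε * t) ≤ 2 * T := by
        have : ε * t ≤ 1 := mul_le_one₀ hε1 ht0 (by linarith [ht.2])
        nlinarith
      rw [hMeq t ht0]
      set a := T * (1 + ε * t) with ha
      have ha0 : 0 < a := hT0.trans_le hTa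
      have hρ := le_cartanDensity hT₀0 (hT₀T.trans hTa)
      calc K * (Real.pi * N * a * M t) ^ 2
          = M t ^ 2 * ((1 - δ₀ ^ 2) / 2 * a * (a / (2 * T))) := by
            have := Real.pi_pos
            rw [hK]; field_simp; ring
        _ ≤ M t ^ 2 * ((1 - δ₀ ^ 2) / 2 * a * 1) := by
            gcongr
            rw [div_le_one (by positivity)]; exact haT
        _ ≤ M t ^ 2 * cartanDensity a := by rw [mul_one]; gcongr
  have hK0 : 0 ≤ K := by have := Real.pi_pos; positivity
  have hpow : (n : ℝ) ^ (-(2 / 3) : ℝ) * T ^ (4 / 3 : ℝ) = (N ^ 2)⁻¹ := by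
    rw [← hmN, ← hnT, Real.div_rpow hn'.le (by positivity), ← Real.rpow_natCast T 2,
      ← Real.rpow_mul hT0.le, div_eq_mul_inv (_ ^ _), ← Real.rpow_neg hT0.le]
    norm_num
  calc _ = c * (1 - δ₀ ^ 2) / (4 * Real.pi ^ 2) * ε *
        ((n : ℝ) ^ (-(2 / 3) : ℝ) * T ^ (4 / 3 : ℝ)) := by ring
    _ = T * ε * (K * c) := by
      have := Real.pi_pos
      rw [hpow, hK]; field_simp
    _ ≤ T * ε * ∫ t in (1 / 4 : ℝ)..(3 / 4), M t ^ 2 * cartanDensity (T * (1 + ε * t)) := by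
      have h1 := (mul_le_mul_of_nonneg_left hmain hK0).trans hint
      gcongr
    _ ≤ _ := integral_plateau_le_integratedCoeff μ m n hα hε hT1
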